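/- \textbf{Setting.} Let $\mathbb{G}$ be a homogeneous Lie group of dimension at least $1$, written in coordinates in which its dilations are linear (for instance exponential coordinates): the underlying manifold is a finite-dimensional real vector space $V\neq\{0\}$ (identified with the Lie algebra, the tangent space at the identity), the group law is smooth, the identity is $0$, and there is a diagonalisable linear operator $A$ on $V$ with positive eigenvalues such that every dilation $D_\lambda=\exp(A\ln\lambda)$, $\lambda>0$, is an automorphism of $\mathbb{G}$. Write $\lambda x=D_\lambda(x)$, let $Q=\operatorname{Tr}A$ be the homogeneous dimension and $dx$ a Haar measure on $\mathbb{G}$. Let $|\cdot|:\mathbb{G}\to[0,\infty)$ be any homogeneous quasi-norm: it is continuous, $|x^{-1}|=|x|$, $|\lambda x|=\lambda|x|$ for $\lambda>0$, and $|x|=0$ if and only if $x=0$. Put $\mathfrak{S}=\{|x|=1\}$, $B=B(0,R)=\{x:|x|<R\}$ with $R>0$, and $\frac{x}{|x|}=D_{1/|x|}(x)$ for $x\ne0$. The radial derivative is $\mathcal{R}f(x)=\frac{d}{dr}f(ry)\big|_{r=|x|}$, where $y=\frac{x}{|x|}$. For $1<p<\infty$ and $\xi,\eta\in\mathbb{C}$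 put $$C_p(\xi,\eta)=|\xi|^p-|\xi-\eta|^p-p|\xi-\eta|^{p-2}\operatorname{Re}\big((\xi-\eta)\overline{\eta}\big).$$ \textbf{Theorem.} Let $1<p<\infty$ and $\alpha,\beta\in\mathbb{R}$. For $f:\mathbb{G}\to\mathbb{C}$ put $$u_f=\frac{f}{|x|^{\frac{\alpha+p}{p}}\left(\log\frac{R}{|x|}\right)^{\frac{\beta+p+1}{p}}},\qquad \xi_f=\frac{\mathcal{R}f}{|x|^{\frac{\alpha}{p}}\left(\log\frac{R}{|x|}\right)^{\frac{\beta+1}{p}}},\qquad \eta_f=\xi_f+\frac{\beta+p}{p}\,u_f .$$ Then $C_p(\xi,\eta)\ge0$ for all $\xi,\eta\in\mathbb{C}$, and the following hold. (i) If $(Q-\alpha-p)(\beta+p)\ge0$, then for all complex-valued $f\in C_0^\infty(B\setminus\{0\})$ $$\left|\frac{\beta+p}{p}\right|^p\|u_f\|_{L^p(B)}^p\le\|\xi_f\|_{L^p(B)}^p .\qquad(1)$$ If moreover $\beta\neq-p$, the constant is sharp: no constant larger than $\left|\frac{\beta+p}{p}\right|^p$ is possible in (1). (ii) For all complex-valued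 $f\in C_0^\infty(B\setminus\{0\})$ all integrals below are finite and $$\left|\frac{\beta+p}{p}\right|^p\|u_f\|_{L^p(B)}^p=\|\xi_f\|_{L^p(B)}^p-(Q-\alpha-p)\,\frac{\beta+p}{p}\left|\frac{\beta+p}{p}\right|^{p-2}\int_{B}\frac{|f|^p}{|x|^{\alpha+p}\left(\log\frac{R}{|x|}\right)^{\beta+p}}\,dx-\int_{B}C_p(\xi_f,\eta_f)\,dx,$$ where the second term on the right is read as $0$ if $\beta=-p$. (iii) Let $Q=\alpha+p$ and $p\ge2$. (a) If $f:\mathbb{G}\to\mathbb{C}$ is differentiable in the radial direction at every point of $B\setminus\{0\}$, then $C_p(\xi_f,\eta_f)=0$ everywhere on $B\setminus\{0\}$ if and only if there is a function $\varphi:\mathfrak{S}\to\mathbb{C}$ with $$f(x)=\left(\log\frac{R}{|x|}\right)^{\frac{\beta+p}{p}}\varphi\left(\frac{x}{|x|}\right)\quad\text{on }B\setminus\{0\}.\qquad(2)$$ If $f\in C_0^\infty(B\setminus\{0\})$, then $\int_B C_p(\xi_f,\eta_f)\,dx=0$ if and only if (2) holds for some $\varphi$. (b) For $f$ given by (2)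 one has, on $B\setminus\{0\}$, $$|u_f|^p=\frac{|f|^p}{|x|^{\alpha+p}\left(\log\frac{R}{|x|}\right)^{\beta+p+1}}=\frac{\left|\varphi\left(\frac{x}{|x|}\right)\right|^p}{|x|^{Q}\log\frac{R}{|x|}},$$ and $\int_B|u_f|^p\,dx=\infty$ if $\varphi$ is measurable and $f$ is not almost everywhere $0$ on $B$; in particular this is so if $\varphi$ is continuous and not identically $0$. (c) The constant in (1) is not attained: if equality holds in (1) for some $f\in C_0^\infty(B\setminus\{0\})$, then $f=0$. -/

import Mathlib

open MeasureTheory Set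
open scoped ContDiff Manifold

noncomputable section

/-- The structure that makes a Lie group `V` homogeneous.  The group is written in
coordinates in which the dilations are linear, for instance exponential coordinates: its underlying
manifold is a finite-dimensional real vector space `V` (so that it is connected and simply
connected, and `V` is also its Lie algebra, the tangent space at the identity), the identity element
is the origin, and `A` is a diagonalisable linear operator on `V`
with positive eigenvalues such that every dilation `D_λ = exp (log λ • A)`, `λ > 0`, is an
automorphism of the group.  (A linear group automorphism is its own differential at the identity,
so `D_λ` is then an automorphism of the Lie algebra as well.) -/
structure HomogeneousLieGroup (V : Type*) [NormedAddCommGroup V] [NormedSpace ℝ V]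
    [Group V] [LieGroup 𝓘(ℝ, V) ∞ V] where
  /-- the infinitesimal generator of the dilations -/
  A : V →L[ℝ] V
  one_eq_zero : (1 : V) = 0
  diagonalisable : ⨆ ν : ℝ, Module.End.eigenspace (A : V →ₗ[ℝ] V) ν = ⊤
  eigenvalue_pos : ∀ ν : ℝ, Module.End.HasEigenvalue (A : V →ₗ[ℝ] V) ν → 0 < ν
  dilation_mul : ∀ l : ℝ, 0 < l → ∀ x y : V,
    (NormedSpace.exp (Real.log l • A) : V →L[ℝ] V) (x * y) =
      (NormedSpace.exp (Real.log l • A) : V →L[ℝ] V) x *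
        (NormedSpace.exp (Real.log l • A) : V →L[ℝ] V) y

namespace HomogeneousLieGroup

variable {V : Type*} [NormedAddCommGroup V] [NormedSpace ℝ V] [Group V] [LieGroup 𝓘(ℝ, V) ∞ V]

/-- The dilation `D_λ = exp (log λ • A)`; only `λ > 0` is meaningful. -/
def dil (G : HomogeneousLieGroup V) (l : ℝ) : V →L[ℝ] V :=
  NormedSpace.exp (Real.log l • G.A)

/-- The homogeneous dimension `Q = Tr A`. -/
def homDim (G : HomogeneousLieGroup V) : ℝ :=
  LinearMap.trace ℝ V (G.A : V →ₗ[ℝ] V)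

/-- A homogeneous quasi-norm on a homogeneous Lie group (no triangle inequality and no smoothness
is required). -/
structure QuasiNorm (G : HomogeneousLieGroup V) where
  /-- the underlying function `x ↦ |x|` -/
  nrm : V → ℝ
  continuous_nrm : Continuous nrm
  nonneg : ∀ x, 0 ≤ nrm x
  nrm_inv : ∀ x, nrm x⁻¹ = nrm x
  nrm_dil : ∀ l : ℝ, 0 < l → ∀ x, nrm (G.dil l x) = l * nrm x
  nrm_eq_zero_iff : ∀ x, nrm x = 0 ↔ x = 1

namespace QuasiNorm

variable {G : HomogeneousLieGroup V}

/-- The quasi-ball `B(x, R) = {y : |x⁻¹ y| < R}`. -/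
def ball (N : G.QuasiNorm) (x : V) (R : ℝ) : Set V := {y | N.nrm (x⁻¹ * y) < R}

/-- The quasi-ball about the identity element (the origin) with its centre removed. -/
def puncturedBall (N : G.QuasiNorm) (R : ℝ) : Set V := N.ball 1 R \ {1}

/-- The unit quasi-sphere. -/
def sphere (N : G.QuasiNorm) : Set V := {y | N.nrm y = 1}

/-- The point `x / |x|` of the unit quasi-sphere, for `x` different from the identity. -/
def angular (N : G.QuasiNorm) (x : V) : V := G.dil (N.nrm x)⁻¹ x

/-- `f` is differentiable at `x` in the radial direction, i.e. `r ↦ f (r y)` is differentiable at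
`r = |x|`, where `y = x / |x|`. -/
def RadialDifferentiableAt (N : G.QuasiNorm) (f : V → ℂ) (x : V) : Prop :=
  DifferentiableAt ℝ (fun r : ℝ => f (G.dil r (N.angular x))) (N.nrm x)

/-- The radial derivative `d f(x) / d|x|`: the derivative of `r ↦ f (r y)` at `r = |x|`, where
`y = x / |x|`. -/
def radialDeriv (N : G.QuasiNorm) (f : V → ℂ) (x : V) : ℂ :=
  deriv (fun r : ℝ => f (G.dil r (N.angular x))) (N.nrm x)

/-- The complex-valued smooth functions with compact support in the punctured quasi-ball. -/
def testFunctions (N : G.QuasiNorm) (R : ℝ) : Set (V → ℂ) :=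
  {f | ContDiff ℝ ∞ f ∧ HasCompactSupport f ∧ tsupport f ⊆ N.puncturedBall R}

/-- `f / (|x| ^ ((α + p) / p) (log (R / |x|)) ^ ((β + p + 1) / p))`. -/
def hardyTerm (N : G.QuasiNorm) (p α β R : ℝ) (f : V → ℂ) (x : V) : ℂ :=
  f x / ((N.nrm x ^ ((α + p) / p) * Real.log (R / N.nrm x) ^ ((β + p + 1) / p) : ℝ) : ℂ)

/-- `(d f / d|x|) / (|x| ^ (α / p) (log (R / |x|)) ^ ((β + 1) / p))`. -/
def radialTerm (N : G.QuasiNorm) (p α β R : ℝ) (f : V → ℂ) (x : V) : ℂ :=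
  N.radialDeriv f x /
    ((N.nrm x ^ (α / p) * Real.log (R / N.nrm x) ^ ((β + 1) / p) : ℝ) : ℂ)

end QuasiNorm

end HomogeneousLieGroup

/-- `C_p(ξ, η) = |ξ|^p - |ξ - η|^p - p |ξ - η|^(p-2) Re ((ξ - η) * conj η)`. -/
def hardyCp (p : ℝ) (ξ η : ℂ) : ℝ :=
  ‖ξ‖ ^ p - ‖ξ - η‖ ^ p - p * ‖ξ - η‖ ^ (p - 2) * ((ξ - η) * (starRingEnd ℂ) η).re

namespace HomogeneousLieGroup.QuasiNorm

variable {V : Type*} [NormedAddCommGroup V] [NormedSpace ℝ V] [Group V] [LieGroup 𝓘(ℝ, V) ∞ V]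
  {G : HomogeneousLieGroup V}

/-- The remainder density `C_p(ξ, η)`, where `ξ` is the weighted radial derivative of `f` and `η`
is `ξ` plus `(β + p) / p` times the weighted function `f`. -/
def remainder (N : G.QuasiNorm) (p α β R : ℝ) (f : V → ℂ) (x : V) : ℝ :=
  hardyCp p (N.radialTerm p α β R f x)
    (N.radialTerm p α β R f x + (((β + p) / p : ℝ) : ℂ) * N.hardyTerm p α β R f x)

/-- `φ(x / |x|)` for a function `φ` on the unit quasi-sphere.  The point `x / |x|` lies on the
quasi-sphere as soon as `x` is not the identity; at the identity the value is `0` by convention. -/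
def angularFun (N : G.QuasiNorm) (φ : N.sphere → ℂ) (x : V) : ℂ :=
  open Classical in
  if h : N.angular x ∈ N.sphere then φ ⟨N.angular x, h⟩ else 0

/-- The function `(log (R / |x|)) ^ ((β + p) / p) φ(x / |x|)`. -/
def extremal (N : G.QuasiNorm) (p β R : ℝ) (φ : N.sphere → ℂ) (x : V) : ℂ :=
  ((Real.log (R / N.nrm x) ^ ((β + p) / p) : ℝ) : ℂ) * N.angularFun φ x

end HomogeneousLieGroup.QuasiNorm

end

/-! Write `L = log (R / |x|)`, `c = (β + p) / p`, and let `E f (x) = df_x (A x)` be the derivative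
along the generator of the dilations. Since `|x| · ℛf = E f`, everything is a statement about the
field `x ↦ A x`, whose divergence is `Tr A = Q`. The quasi-norm is only continuous, so it is never
differentiated except along dilation orbits, where it is exactly homogeneous.

Haar measure is a multiple of Lebesgue measure. Conjugating by a dilation shows that the Jacobian
determinant of a left translation is the same at `(g, x)` and at the dilated pair; letting the
dilation shrink both points to the identity gives the value 1 (`det_mulLeftFDeriv`). Hence dilations
scale Haar measure by `e ^ (t Q)`, which differentiates to `∫ E F = -Q ∫ F` (`integral_deriv_flow`)
and also yields polar coordinates (`lintegral_polar`).

For the identity, `C_p(ξ, ξ + c u)` equals `|ξ|^p + (p - 1) |c|^p |u|^p` plus `c |c|^(p-2)` times `p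
|u|^(p-2) Re (u ξ̄)`. The weights are such that this cross term is `E(|f|^p) · w` with `w =
|x|^(-α-p) L^(-β-p)`, and `E w = -(α + p) w + (β + p) w / L`. The divergence theorem for `|f|^p w`
then gives the Hardy identity. Inequality (1) follows because `C_p ≥ 0` (Young plus Cauchy–Schwarz)
and the middle term has a sign.

Equality in `C_p ≥ 0` forces `η = 0`, an ordinary differential equation on each dilation orbit whose
solutions are `L^c φ(x / |x|)`. Such a function keeps the same angular factor all the way to the
origin, so it cannot be a nonzero test function; in polar coordinates its left-hand side contains `∫
ds / (log R - s) = ∞`.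

For sharpness a smooth function of `|x|` is not available. A linear functional `l`, homogeneous
under the dilations, gives smooth coordinates: a logarithmic radius `s` and a projection `y` to `l =
1`. For product functions `g(s) ψ(y)` with `ψ` concentrated near a point where `|y| = 1`, `log |x| =
s + log |y|` is almost `s`, so the inequality descends to one dimension with an arbitrarily small
loss (`integral_cone_weight_comparison`). There, cut-offs of `(log R - s)^c`, logarithmically spread
near `s = log R`, give the constant (`le_of_forall_oneDim`). -/

open MeasureTheory Set
open scoped ContDiff Manifold

set_option linter.unusedSectionVars false

noncomputable section

/-! ### Positivity and zeros of the functional `C_p`. -/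

section Cp

/-- The strict form of Young's inequality behind the positivity of `hardyCp`. -/
theorem young_pow_le {p a b : ℝ} (hp : 1 < p) (ha : 0 ≤ a) (hb : 0 ≤ b) :
    p * b ^ (p - 1) * a ≤ a ^ p + (p - 1) * b ^ p ∧
      (a ≠ b → p * b ^ (p - 1) * a < a ^ p + (p - 1) * b ^ p) := by
  rcases hb.eq_or_lt with rfl | hb
  · rw [Real.zero_rpow (by linarith), Real.zero_rpow (by linarith)]
    refine ⟨by simpa using Real.rpow_nonneg ha p, fun h => ?_⟩
    simpa using Real.rpow_pos_of_pos (lt_of_le_of_ne ha (Ne.symm h)) p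
  have hbp : 0 < b ^ p := Real.rpow_pos_of_pos hb p
  -- Division by `b ^ p` reduces the claim to Bernoulli's inequality `(1 + s)^p ≥ 1 + p s` at `s = a
  -- / b - 1`, strict for `s ≠ 0`.
  have hs : -1 ≤ a / b - 1 := by have := div_nonneg ha hb.le; linarith
  have e1 : (1 + (a / b - 1)) ^ p = a ^ p / b ^ p := by
    rw [add_sub_cancel, Real.div_rpow ha hb.le]
  have e2 : p * b ^ (p - 1) * a = b ^ p * (p * (a / b)) := by
    rw [Real.rpow_sub_one hb.ne']; ring
  have e3 : a ^ p + (p - 1) * b ^ p = b ^ p * (a ^ p / b ^ p + (p - 1)) := by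
    field_simp
  rw [e2, e3]
  constructor
  · refine mul_le_mul_of_nonneg_left ?_ hbp.le
    have := one_add_mul_self_le_rpow_one_add hs hp.le
    rw [e1] at this; linarith
  · intro hne
    refine mul_lt_mul_of_pos_left ?_ hbp
    have := one_add_mul_self_lt_rpow_one_add hs (by
      intro h
      exact hne ((div_eq_one_iff_eq hb.ne').1 (by linarith))) hp
    rw [e1] at this; linarith

/-- At `a = 0` the factor `a ^ 2` absorbs whatever value `0 ^ (p - 2)` receives, so the formula also
holds for `p < 2`. -/
theorem rpow_sub_two_mul_sq {p a : ℝ} (hp : 1 < p) (ha : 0 ≤ a) : a ^ (p - 2) * a ^ 2 = a ^ p := by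
  rcases ha.eq_or_lt with rfl | ha
  · rw [Real.zero_rpow (by linarith : p ≠ 0)]; simp
  · rw [← Real.rpow_natCast, ← Real.rpow_add ha]; congr 1; push_cast; ring

theorem rpow_sub_two_mul_self {p a : ℝ} (hp : 1 < p) (ha : 0 ≤ a) :
    a ^ (p - 2) * a = a ^ (p - 1) := by
  rcases ha.eq_or_lt with rfl | ha
  · rw [Real.zero_rpow (by linarith : p - 1 ≠ 0)]; simp
  · rw [← Real.rpow_add_one ha.ne']; congr 1; ring

/-- With `z = ξ - η`, `Re (z η̄) = Re (z ξ̄) - |z|²`. In this form Cauchy–Schwarz bounds the pairing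
by `|z| |ξ|`, and what remains is Young's inequality for `|ξ|` and `|z|`. -/
theorem hardyCp_eq {p : ℝ} (hp : 1 < p) (ξ η : ℂ) :
    hardyCp p ξ η = ‖ξ‖ ^ p + (p - 1) * ‖ξ - η‖ ^ p
      - p * ‖ξ - η‖ ^ (p - 2) * ((ξ - η) * (starRingEnd ℂ) ξ).re := by
  have h : ((ξ - η) * (starRingEnd ℂ) η).re =
      ((ξ - η) * (starRingEnd ℂ) ξ).re - ‖ξ - η‖ ^ 2 := by
    rw [← Complex.normSq_eq_norm_sq, Complex.normSq_apply]
    simp only [Complex.mul_re, Complex.conj_re, Complex.conj_im, Complex.sub_re, Complex.sub_im]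
    ring
  rw [hardyCp, h, ← rpow_sub_two_mul_sq hp (norm_nonneg (ξ - η))]
  ring

theorem re_mul_conj_le (z w : ℂ) : (z * (starRingEnd ℂ) w).re ≤ ‖z‖ * ‖w‖ := by
  simpa using Complex.re_le_norm (z * (starRingEnd ℂ) w)

theorem hardyCp_lower {p : ℝ} (hp : 1 < p) (ξ η : ℂ) :
    ‖ξ‖ ^ p + (p - 1) * ‖ξ - η‖ ^ p - p * ‖ξ - η‖ ^ (p - 1) * ‖ξ‖ ≤ hardyCp p ξ η := by
  rw [hardyCp_eq hp, ← rpow_sub_two_mul_self hp (norm_nonneg (ξ - η))]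
  have h0 : 0 ≤ p * ‖ξ - η‖ ^ (p - 2) :=
    mul_nonneg (by linarith) (Real.rpow_nonneg (norm_nonneg _) _)
  have := mul_le_mul_of_nonneg_left (re_mul_conj_le (ξ - η) ξ) h0
  linarith

theorem hardyCp_nonneg {p : ℝ} (hp : 1 < p) (ξ η : ℂ) : 0 ≤ hardyCp p ξ η := by
  have := hardyCp_lower hp ξ η
  have := (young_pow_le hp (norm_nonneg ξ) (norm_nonneg (ξ - η))).1
  linarith

/-- Equality in Young forces `|ξ| = |ξ - η|`; then equality in Cauchy–Schwarz gives `Re ((ξ - η) ξ̄)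
= |ξ - η|²`, and expanding `|η|² = |ξ - (ξ - η)|²` yields 0. -/
theorem hardyCp_eq_zero_iff {p : ℝ} (hp : 1 < p) (ξ η : ℂ) : hardyCp p ξ η = 0 ↔ η = 0 := by
  constructor
  · intro h
    have hn : ‖ξ‖ = ‖ξ - η‖ := by
      by_contra hne
      have := hardyCp_lower hp ξ η
      have := (young_pow_le hp (norm_nonneg ξ) (norm_nonneg (ξ - η))).2 hne
      linarith
    rcases (norm_nonneg (ξ - η)).eq_or_lt with h0 | h0
    · have h1 := norm_eq_zero.1 h0.symm
      have h2 : ξ = 0 := by rw [← norm_eq_zero, hn, ← h0]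
      simpa [h2] using h1
    · have hq : 0 < p * ‖ξ - η‖ ^ (p - 2) :=
        mul_pos (by linarith) (Real.rpow_pos_of_pos h0 _)
      have h3 : p * ‖ξ - η‖ ^ (p - 2) * (‖ξ - η‖ ^ 2 - ((ξ - η) * (starRingEnd ℂ) ξ).re) = 0 := by
        rw [hardyCp_eq hp, hn, ← rpow_sub_two_mul_sq hp h0.le] at h
        linarith
      have h4 := (mul_eq_zero.1 h3).resolve_left hq.ne'
      have h5 : ‖η‖ ^ 2 = ‖ξ‖ ^ 2 + ‖ξ - η‖ ^ 2 - 2 * ((ξ - η) * (starRingEnd ℂ) ξ).re := by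
        simp only [← Complex.normSq_eq_norm_sq, Complex.normSq_apply, Complex.mul_re,
          Complex.conj_re, Complex.conj_im, Complex.sub_re, Complex.sub_im]
        ring
      rw [hn] at h5
      have h6 : ‖η‖ ^ 2 = 0 := by linarith
      simpa using h6
  · rintro rfl
    simp [hardyCp]

end Cp

/-! ### Dilations as a diagonalisable linear flow. -/

namespace HomogeneousLieGroup

variable {V : Type*} [NormedAddCommGroup V] [NormedSpace ℝ V] [Group V] [LieGroup 𝓘(ℝ, V) ∞ V]

/-- The one-parameter group `exp (t A)` of dilations in logarithmic time. -/
def flow (G : HomogeneousLieGroup V) (t : ℝ) : V →L[ℝ] V := NormedSpace.exp (t • G.A)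

theorem dil_eq_flow (G : HomogeneousLieGroup V) (l : ℝ) : G.dil l = G.flow (Real.log l) := rfl

theorem flow_mul (G : HomogeneousLieGroup V) (t : ℝ) (x y : V) :
    G.flow t (x * y) = G.flow t x * G.flow t y := by
  simpa [flow] using G.dilation_mul (Real.exp t) (Real.exp_pos t) x y

theorem flow_zero (G : HomogeneousLieGroup V) (x : V) : G.flow 0 x = x := by
  simp [flow, NormedSpace.exp_zero]

variable [FiniteDimensional ℝ V]

theorem exists_eigenbasis (G : HomogeneousLieGroup V) :
    ∃ (b : Module.Basis (Fin (Module.finrank ℝ V)) ℝ V) (ν : Fin (Module.finrank ℝ V) → ℝ),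
      (∀ i, G.A (b i) = ν i • b i) ∧ ∀ i, 0 < ν i := by
  classical
  have hint := DirectSum.isInternal_submodule_of_iSupIndep_of_iSup_eq_top
    (Module.End.eigenspaces_iSupIndep (G.A : V →ₗ[ℝ] V)) G.diagonalisable
  let b := hint.collectedBasis fun ν => Module.finBasis ℝ _
  -- The eigenspaces are indexed by all real numbers, but almost all of them are zero; finite
  -- dimension makes the collected basis finite.
  have : Finite (Σ ν : ℝ, Fin (Module.finrank ℝ
      (Module.End.eigenspace (G.A : V →ₗ[ℝ] V) ν))) := Module.Finite.finite_basis b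
  have := Fintype.ofFinite (Σ ν : ℝ, Fin (Module.finrank ℝ
      (Module.End.eigenspace (G.A : V →ₗ[ℝ] V) ν)))
  let e := Fintype.equivFinOfCardEq (Module.finrank_eq_card_basis b).symm
  have hmem : ∀ a, b a ∈ Module.End.eigenspace (G.A : V →ₗ[ℝ] V) a.1 := fun a =>
    hint.collectedBasis_mem _ a
  refine ⟨b.reindex e, fun i => (e.symm i).1, fun i => ?_, fun i => ?_⟩
  · simpa using Module.End.mem_eigenspace_iff.1 (hmem (e.symm i))
  · exact G.eigenvalue_pos _
      (Module.End.hasEigenvalue_of_hasEigenvector ⟨hmem (e.symm i), b.ne_zero _⟩)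

theorem hasDerivAt_flow (G : HomogeneousLieGroup V) (t : ℝ) (x : V) :
    HasDerivAt (fun s => G.flow s x) (G.A (G.flow t x)) t := by
  have := FiniteDimensional.complete ℝ V
  have h := hasDerivAt_exp_smul_const' (𝕂 := ℝ) G.A t
  exact (ContinuousLinearMap.apply ℝ V x).hasFDerivAt.comp_hasDerivAt t h

theorem flow_add (G : HomogeneousLieGroup V) (s t : ℝ) (x : V) :
    G.flow (s + t) x = G.flow s (G.flow t x) := by
  have := FiniteDimensional.complete ℝ V
  let _ : NormedAlgebra ℚ (V →L[ℝ] V) := .restrictScalars ℚ ℝ _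
  have : Commute (s • G.A) (t • G.A) := ((Commute.refl G.A).smul_left s).smul_right t
  rw [flow, add_smul, NormedSpace.exp_add_of_commute this]
  rfl

/-- The curve `e^(-tν) D_t v` has zero derivative and equals `v` at `t = 0`. -/
theorem flow_eigenvector (G : HomogeneousLieGroup V) {v : V} {ν : ℝ} (h : G.A v = ν • v) (t : ℝ) :
    G.flow t v = Real.exp (t * ν) • v := by
  have := FiniteDimensional.complete ℝ V
  have hd : ∀ t, HasDerivAt (fun s => Real.exp (-(s * ν)) • G.flow s v) 0 t := by
    intro t
    have h1 : HasDerivAt (fun s => G.flow s v) (ν • G.flow t v) t := by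
      -- The form of the derivative with `A` on the right is used, so that `A` acts on the
      -- eigenvector first.
      have h0 := hasDerivAt_exp_smul_const (𝕂 := ℝ) G.A t
      have := (ContinuousLinearMap.apply ℝ V v).hasFDerivAt.comp_hasDerivAt t h0
      convert! this using 1
      change _ = G.flow t (G.A v)
      rw [h, map_smul]
    have h2 : HasDerivAt (fun s => Real.exp (-(s * ν))) (Real.exp (-(t * ν)) * -ν) t := by
      have := ((hasDerivAt_id t).mul_const ν).neg.exp
      simpa using this
    convert! h2.smul h1 using 1
    simp [smul_smul]
  have := is_const_of_deriv_eq_zero (fun t => (hd t).differentiableAt) (fun t => (hd t).deriv) t 0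
  simp only [zero_mul, neg_zero, Real.exp_zero, one_smul, flow_zero] at this
  rw [← eq_inv_smul_iff₀ (Real.exp_pos _).ne', ← Real.exp_neg, neg_neg] at this
  exact this

theorem flow_eq_sum (G : HomogeneousLieGroup V) {ι : Type*} [Fintype ι] (b : Module.Basis ι ℝ V)
    {ν : ι → ℝ} (h : ∀ i, G.A (b i) = ν i • b i) (t : ℝ) (x : V) :
    G.flow t x = ∑ i, (Real.exp (t * ν i) * b.repr x i) • b i := by
  conv_lhs => rw [← b.sum_repr x]
  rw [map_sum]
  refine Finset.sum_congr rfl fun i _ => ?_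
  rw [map_smul, G.flow_eigenvector (h i), smul_smul, mul_comm]

/-- In an eigenbasis both operators are diagonal, so `∏ e^(t ν_i) = e^(t Σ ν_i)`. This is where the
homogeneous dimension enters. -/
theorem det_flow (G : HomogeneousLieGroup V) (t : ℝ) :
    (G.flow t).det = Real.exp (t * G.homDim) := by
  classical
  obtain ⟨b, ν, hb, -⟩ := G.exists_eigenbasis
  have h1 : LinearMap.toMatrix b b (G.flow t : V →ₗ[ℝ] V) =
      Matrix.diagonal fun i => Real.exp (t * ν i) := by
    ext i j
    rw [LinearMap.toMatrix_apply, ContinuousLinearMap.coe_coe, G.flow_eigenvector (hb j),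
      map_smul, Module.Basis.repr_self, Matrix.diagonal_apply]
    by_cases hij : i = j
    · subst hij; simp
    · simp [hij]
  have h2 : LinearMap.toMatrix b b (G.A : V →ₗ[ℝ] V) = Matrix.diagonal ν := by
    ext i j
    rw [LinearMap.toMatrix_apply, ContinuousLinearMap.coe_coe, hb j,
      map_smul, Module.Basis.repr_self, Matrix.diagonal_apply]
    by_cases hij : i = j
    · subst hij; simp
    · simp [hij]
  rw [ContinuousLinearMap.det, ← LinearMap.det_toMatrix b, h1, Matrix.det_diagonal,
    homDim, LinearMap.trace_eq_matrix_trace ℝ b, h2, Matrix.trace_diagonal, Finset.mul_sum,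
    Real.exp_sum]

theorem tendsto_flow_atBot (G : HomogeneousLieGroup V) (x : V) :
    Filter.Tendsto (fun t => G.flow t x) Filter.atBot (nhds 0) := by
  obtain ⟨b, ν, hb, hν⟩ := G.exists_eigenbasis
  simp_rw [G.flow_eq_sum b hb]
  have : (0 : V) = ∑ i, ((0 : ℝ) * b.repr x i) • b i := by simp
  rw [this]
  refine tendsto_finsetSum _ fun i _ => ((Filter.Tendsto.mul_const _ ?_).smul_const _)
  exact Real.tendsto_exp_atBot.comp (Filter.tendsto_id.atBot_mul_const (hν i))

theorem contDiff_flow (G : HomogeneousLieGroup V) : ContDiff ℝ ∞ fun q : ℝ × V => G.flow q.1 q.2 := by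
  obtain ⟨b, ν, hb, -⟩ := G.exists_eigenbasis
  simp_rw [G.flow_eq_sum b hb]
  refine ContDiff.sum fun i _ => ContDiff.smul (ContDiff.mul ?_ ?_) contDiff_const
  · exact (contDiff_fst.mul contDiff_const).exp
  · exact ((b.coord i).toContinuousLinearMap.contDiff).comp contDiff_snd

theorem continuous_flow (G : HomogeneousLieGroup V) : Continuous fun q : ℝ × V => G.flow q.1 q.2 :=
  G.contDiff_flow.continuous

end HomogeneousLieGroup

/-! ### Haar measure, integration by parts and polar coordinates. -/

namespace HomogeneousLieGroup

variable {V : Type*} [NormedAddCommGroup V] [NormedSpace ℝ V] [Group V] [LieGroup 𝓘(ℝ, V) ∞ V]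

theorem contDiff_group_mul : ContDiff ℝ ∞ fun q : V × V => q.1 * q.2 := by
  have h := contMDiff_mul 𝓘(ℝ, V) (G := V) ∞
  -- The product model and charts on `V × V` are those of the vector space itself, where manifold
  -- smoothness is ordinary smoothness.
  rw [← modelWithCornersSelf_prod, chartedSpaceSelf_prod] at h
  exact h.contDiff

/-- The differential at `x` of the left translation by `g`. -/
def mulLeftFDeriv (g x : V) : V →L[ℝ] V := fderiv ℝ (fun y => g * y) x

theorem hasFDerivAt_mul_left (g x : V) : HasFDerivAt (fun y => g * y) (mulLeftFDeriv g x) x := by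
  have h : ContDiff ℝ ∞ fun y : V => g * y :=
    contDiff_group_mul.comp (contDiff_const.prodMk contDiff_id)
  exact (h.differentiable (by simp) x).hasFDerivAt

theorem continuous_mulLeftFDeriv : Continuous fun q : V × V => mulLeftFDeriv q.1 q.2 := by
  have h : ∀ q : V × V, mulLeftFDeriv q.1 q.2 =
      (fderiv ℝ (fun q : V × V => q.1 * q.2) q).comp (ContinuousLinearMap.inr ℝ V V) := by
    intro q
    refine (hasFDerivAt_mul_left q.1 q.2).unique ?_
    exact ((contDiff_group_mul (V := V)).differentiable (by simp) (q.1, q.2)).hasFDerivAt.comp q.2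
      (hasFDerivAt_prodMk_right q.1 q.2)
  simp_rw [h]
  exact ((contDiff_group_mul (V := V)).continuous_fderiv (by simp)).clm_comp continuous_const

variable [FiniteDimensional ℝ V]

/-- In coordinates with linear dilations the left translations preserve volume. -/
theorem det_mulLeftFDeriv (G : HomogeneousLieGroup V) (g x : V) : (mulLeftFDeriv g x).det = 1 := by
  -- A dilation is a linear automorphism, so it conjugates translation by `g` into translation by
  -- the dilated `g`; its own determinant cancels.
  have hinv : ∀ t, (mulLeftFDeriv (G.flow t g) (G.flow t x)).det = (mulLeftFDeriv g x).det := by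
    intro t
    have h1 : HasFDerivAt (fun y => G.flow t (g * y))
        ((G.flow t).comp (mulLeftFDeriv g x)) x :=
      (G.flow t).hasFDerivAt.comp x (hasFDerivAt_mul_left g x)
    have h2 : HasFDerivAt (fun y => G.flow t (g * y))
        ((mulLeftFDeriv (G.flow t g) (G.flow t x)).comp (G.flow t)) x := by
      simp_rw [flow_mul]
      exact (hasFDerivAt_mul_left (G.flow t g) (G.flow t x)).comp x (G.flow t).hasFDerivAt
    have h3 := congrArg ContinuousLinearMap.det (h1.unique h2)
    have hd : (G.flow t).det ≠ 0 := by rw [det_flow]; exact (Real.exp_pos _).ne'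
    simp only [ContinuousLinearMap.det, ContinuousLinearMap.toLinearMap_comp,
      LinearMap.det_comp] at h3 hd ⊢
    exact mul_right_cancel₀ hd (by rw [← h3]; ring)
  -- As `t → -∞` both points tend to the identity, where the translation is the identity map.
  have hlim : Filter.Tendsto (fun t => (mulLeftFDeriv (G.flow t g) (G.flow t x)).det)
      Filter.atBot (nhds (mulLeftFDeriv (0 : V) 0).det) :=
    ((ContinuousLinearMap.continuous_det.comp continuous_mulLeftFDeriv).tendsto (0, 0)).comp
      ((G.tendsto_flow_atBot g).prodMk_nhds (G.tendsto_flow_atBot x))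
  simp_rw [hinv] at hlim
  rw [tendsto_nhds_unique tendsto_const_nhds hlim]
  have h0 : mulLeftFDeriv (0 : V) 0 = ContinuousLinearMap.id ℝ V := by
    refine (hasFDerivAt_mul_left (0 : V) 0).unique ?_
    simp_rw [← G.one_eq_zero, one_mul]
    exact hasFDerivAt_id _
  rw [h0, ContinuousLinearMap.det]
  simp

variable [MeasurableSpace V] [BorelSpace V]

/-- Change of variables with Jacobian 1; the preimage under `g` is written as the image under `g⁻¹`.
-/
theorem isMulLeftInvariant_addHaar (G : HomogeneousLieGroup V) (lam : Measure V)
    [lam.IsAddHaarMeasure] : lam.IsMulLeftInvariant := by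
  constructor
  intro g
  have hcont : ∀ g : V, Continuous fun x : V => g * x := fun g =>
    continuous_iff_continuousAt.2 fun x => (hasFDerivAt_mul_left g x).continuousAt
  ext s hs
  rw [Measure.map_apply (hcont g).measurable hs]
  have himg : (fun x : V => g * x) ⁻¹' s = (fun x : V => g⁻¹ * x) '' s := by
    ext x
    simp only [mem_preimage, mem_image]
    exact ⟨fun h => ⟨_, h, inv_mul_cancel_left g x⟩, by rintro ⟨y, hy, rfl⟩; simpa using hy⟩
  rw [himg, ← lintegral_abs_det_fderiv_eq_addHaar_image lam hs
    (fun x _ => (hasFDerivAt_mul_left g⁻¹ x).hasFDerivWithinAt)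
    (fun x _ y _ h => mul_left_cancel h)]
  simp [G.det_mulLeftFDeriv]

/-- Uniqueness of Haar measure, applied to Lebesgue measure, which is left invariant as well.
Through this multiple, `μ` inherits the scaling of Lebesgue measure under linear maps. -/
theorem exists_haar_eq_smul (G : HomogeneousLieGroup V) (μ : Measure V) [μ.IsHaarMeasure]
    (lam : Measure V) [lam.IsAddHaarMeasure] : ∃ c : NNReal, μ = c • lam := by
  have : IsTopologicalGroup V := topologicalGroup_of_lieGroup 𝓘(ℝ, V) ∞
  have := G.isMulLeftInvariant_addHaar lam
  have : lam.IsHaarMeasure :=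
    { lt_top_of_isCompact := fun K hK => hK.measure_lt_top
      open_pos := fun U hU hne => hU.measure_ne_zero lam hne }
  have : ProperSpace V := FiniteDimensional.proper_real V
  exact ⟨_, Measure.isMulLeftInvariant_eq_smul μ lam⟩

theorem map_flow (G : HomogeneousLieGroup V) (μ : Measure V) [μ.IsHaarMeasure] (t : ℝ) :
    μ.map (G.flow t) = ENNReal.ofReal (Real.exp (-(t * G.homDim))) • μ := by
  have : ProperSpace V := FiniteDimensional.proper_real V
  obtain ⟨c, hc⟩ := G.exists_haar_eq_smul μ Measure.addHaar
  have hd := G.det_flow t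
  rw [ContinuousLinearMap.det] at hd
  rw [hc]
  ext s hs
  rw [Measure.map_apply (G.flow t).continuous.measurable hs]
  simp only [Measure.smul_apply]
  rw [Measure.addHaar_preimage_continuousLinearMap _ (by rw [hd]; exact (Real.exp_pos _).ne'), hd,
    ← Real.exp_neg, abs_of_pos (Real.exp_pos _)]
  simp only [ENNReal.smul_def, smul_eq_mul]
  ring

theorem lintegral_comp_flow (G : HomogeneousLieGroup V) (μ : Measure V) [μ.IsHaarMeasure] (t : ℝ)
    {F : V → ENNReal} (hF : Measurable F) :
    ∫⁻ x, F x ∂μ = ENNReal.ofReal (Real.exp (t * G.homDim)) * ∫⁻ x, F (G.flow t x) ∂μ := by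
  have h := lintegral_map (μ := μ) hF (G.flow t).continuous.measurable
  rw [map_flow, lintegral_smul_measure, smul_eq_mul] at h
  rw [← h, ← mul_assoc, ← ENNReal.ofReal_mul (Real.exp_pos _).le, ← Real.exp_add]
  simp

theorem integral_comp_flow (G : HomogeneousLieGroup V) (μ : Measure V) [μ.IsHaarMeasure] (t : ℝ)
    {F : V → ℝ} (hF : Continuous F) :
    ∫ x, F (G.flow t x) ∂μ = Real.exp (-(t * G.homDim)) * ∫ x, F x ∂μ := by
  have h := integral_map (μ := μ) (G.flow t).continuous.measurable.aemeasurable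
    hF.aestronglyMeasurable
  rw [map_flow, integral_smul_measure, ENNReal.toReal_ofReal (Real.exp_pos _).le,
    smul_eq_mul] at h
  exact h.symm

/-- Integration by parts along the dilations: the divergence of the generator `A` is its trace. -/
theorem integral_deriv_flow (G : HomogeneousLieGroup V) (μ : Measure V) [μ.IsHaarMeasure]
    {F F' : V → ℝ} (hF : Continuous F) (hFc : HasCompactSupport F) (hF' : Continuous F')
    (hF'c : HasCompactSupport F')
    (hd : ∀ x, HasDerivAt (fun t => F (G.flow t x)) (F' x) 0) :
    ∫ x, F' x ∂μ = -G.homDim * ∫ x, F x ∂μ := by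
  have : IsTopologicalGroup V := topologicalGroup_of_lieGroup 𝓘(ℝ, V) ∞
  have hd' : ∀ x t, HasDerivAt (fun t => F (G.flow t x)) (F' (G.flow t x)) t := by
    intro x t
    have h0 : HasDerivAt (fun s => F (G.flow s (G.flow t x))) (F' (G.flow t x)) (t - t) := by
      rw [sub_self]; exact hd _
    have := h0.comp_sub_const t t
    simpa [← flow_add] using this
  -- A compact set containing every point that some `D_t` with `|t| ≤ 1` carries into the support of
  -- `F'`; a constant on `K` dominates all the derivatives at once.
  set K : Set V := (fun q : ℝ × V => G.flow q.1 q.2) '' (Icc (-1) 1 ×ˢ tsupport F') with hK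
  have hKc : IsCompact K := (isCompact_Icc.prod hF'c).image G.continuous_flow
  obtain ⟨C, hC⟩ := hF'.bounded_above_of_compact_support hF'c
  have hC0 : 0 ≤ C := (norm_nonneg _).trans (hC 0)
  have key := (hasDerivAt_integral_of_dominated_loc_of_deriv_le (μ := μ)
    (F := fun t x => F (G.flow t x)) (F' := fun t x => F' (G.flow t x)) (x₀ := 0)
    (s := Icc (-1) 1) (bound := K.indicator fun _ => C)
    (Icc_mem_nhds (by norm_num) (by norm_num))
    (Filter.Eventually.of_forall fun t => (hF.comp (G.flow t).continuous).aestronglyMeasurable)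
    (by simpa only [flow_zero] using hF.integrable_of_hasCompactSupport hFc)
    (hF'.comp (G.flow 0).continuous).aestronglyMeasurable
    (Filter.Eventually.of_forall fun x t ht => by
      by_cases hx : x ∈ K
      · rw [indicator_of_mem hx]; exact hC _
      · have : F' (G.flow t x) = 0 := by
          by_contra hne
          refine hx ⟨(-t, G.flow t x), ⟨⟨by linarith [ht.2], by linarith [ht.1]⟩,
            subset_tsupport _ hne⟩, ?_⟩
          simp [← flow_add, flow_zero]
        rw [this, norm_zero]
        exact indicator_nonneg (fun _ _ => hC0) _)
    ((integrable_indicator_iff hKc.measurableSet).2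
      (integrableOn_const hKc.measure_lt_top.ne))
    (Filter.Eventually.of_forall fun x t _ => hd' x t)).2
  -- The differentiated integral is also the explicit function `e^(-tQ) ∫ F`; the two derivatives at
  -- `t = 0` agree.
  simp only [G.integral_comp_flow μ _ hF, flow_zero] at key
  have h2 : HasDerivAt (fun t => Real.exp (-(t * G.homDim)) * ∫ x, F x ∂μ)
      (-G.homDim * ∫ x, F x ∂μ) 0 := by
    have := (((hasDerivAt_id (0 : ℝ)).mul_const G.homDim).neg.exp).mul_const (∫ x, F x ∂μ)
    simpa using this
  exact key.unique h2

/-- Polar coordinates for a logarithmic radius `σ` on a dilation-invariant set `D`. -/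
theorem lintegral_polar (G : HomogeneousLieGroup V) (μ : Measure V) [μ.IsHaarMeasure]
    {D : Set V} (hD : MeasurableSet D) (hDinv : ∀ t x, x ∈ D → G.flow t x ∈ D)
    {σ : V → ℝ} (hσ : Measurable σ) (hσt : ∀ t, ∀ x ∈ D, σ (G.flow t x) = σ x + t)
    {H : ℝ → ENNReal} (hH : Measurable H) {h : V → ENNReal} (hh : Measurable h)
    (hhinv : ∀ t, ∀ x ∈ D, h (G.flow t x) = h x) :
    ∫⁻ x in D, H (σ x) * h x ∂μ =
      (∫⁻ x in D ∩ σ ⁻¹' Ico 0 1, ENNReal.ofReal (Real.exp (-(σ x * G.homDim))) * h x ∂μ) *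
        ∫⁻ s, H s * ENNReal.ofReal (Real.exp (s * G.homDim)) := by
  have : IsTopologicalGroup V := topologicalGroup_of_lieGroup 𝓘(ℝ, V) ∞
  have : ProperSpace V := FiniteDimensional.proper_real V
  set S : Set V := D ∩ σ ⁻¹' Ico 0 1 with hS
  have hSm : MeasurableSet S := hD.inter (hσ measurableSet_Ico)
  -- The logarithmic radius moves at unit speed along an orbit, so every orbit in `D` spends exactly
  -- unit time in the slab `S`. This factor 1 is inserted in the integral; Tonelli, the change of
  -- variables `x ↦ D_t x` and the translation `s = σ x + t` then separate the variables.
  have hone : ∀ x ∈ D, ∫⁻ t, S.indicator (fun _ => (1 : ENNReal)) (G.flow (-t) x) = 1 := by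
    intro x hx
    have : (fun t => S.indicator (fun _ => (1 : ENNReal)) (G.flow (-t) x)) =
        (Ioc (σ x - 1) (σ x)).indicator fun _ => 1 := by
      ext t
      have : G.flow (-t) x ∈ S ↔ t ∈ Ioc (σ x - 1) (σ x) := by
        simp only [hS, mem_inter_iff, hDinv _ _ hx, mem_preimage, hσt _ _ hx, true_and, mem_Ico,
          mem_Ioc]
        constructor <;> rintro ⟨h1, h2⟩ <;> constructor <;> linarith
      by_cases ht : t ∈ Ioc (σ x - 1) (σ x)
      · rw [indicator_of_mem ht, indicator_of_mem (this.2 ht)]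
      · rw [indicator_of_notMem ht, indicator_of_notMem (fun h => ht (this.1 h))]
    rw [this, lintegral_indicator measurableSet_Ioc]
    simp
  have hflow : Measurable fun q : V × ℝ => G.flow (-q.2) q.1 :=
    (G.continuous_flow.comp (by fun_prop : Continuous fun q : V × ℝ => (-q.2, q.1))).measurable
  have hSi : Measurable (S.indicator fun _ => (1 : ENNReal)) := measurable_const.indicator hSm
  set P : V → ENNReal := D.indicator fun x => H (σ x) * h x with hP
  have hPm : Measurable P := ((hH.comp hσ).mul hh).indicator hD
  calc ∫⁻ x in D, H (σ x) * h x ∂μ = ∫⁻ x, P x ∂μ := by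
        rw [hP, lintegral_indicator hD]
    _ = ∫⁻ x, (∫⁻ t : ℝ, P x * S.indicator (fun _ => 1) (G.flow (-t) x)) ∂μ := by
        refine lintegral_congr fun x => ?_
        have hm : Measurable fun t : ℝ => S.indicator (fun _ => (1 : ENNReal)) (G.flow (-t) x) :=
          hSi.comp (hflow.comp measurable_prodMk_left)
        rw [lintegral_const_mul _ hm]
        by_cases hx : x ∈ D
        · rw [hone x hx, mul_one]
        · simp [hP, hx]
    _ = ∫⁻ t, ∫⁻ x, P x * S.indicator (fun _ => 1) (G.flow (-t) x) ∂μ :=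
        lintegral_lintegral_swap
          ((hPm.comp measurable_fst).mul (hSi.comp hflow)).aemeasurable
    _ = ∫⁻ t, ∫⁻ x, ENNReal.ofReal (Real.exp (t * G.homDim)) *
          (P (G.flow t x) * S.indicator (fun _ => 1) x) ∂μ := by
        refine lintegral_congr fun t => ?_
        have hm : Measurable fun x => P (G.flow t x) * S.indicator (fun _ => (1 : ENNReal)) x :=
          (hPm.comp (G.flow t).continuous.measurable).mul hSi
        rw [lintegral_const_mul _ hm, G.lintegral_comp_flow μ t
            (F := fun x => P x * S.indicator (fun _ => 1) (G.flow (-t) x))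
            (hPm.mul (hSi.comp (G.flow (-t)).continuous.measurable))]
        simp [← flow_add, flow_zero]
    _ = ∫⁻ x, (∫⁻ t : ℝ, ENNReal.ofReal (Real.exp (t * G.homDim)) *
          (P (G.flow t x) * S.indicator (fun _ => 1) x)) ∂μ := by
        refine lintegral_lintegral_swap (Measurable.aemeasurable ?_)
        refine Measurable.mul ?_ ((hPm.comp G.continuous_flow.measurable).mul
          (hSi.comp measurable_snd))
        exact (Real.measurable_exp.comp (measurable_fst.mul_const _)).ennreal_ofReal
    _ = ∫⁻ x, S.indicator (fun x => ENNReal.ofReal (Real.exp (-(σ x * G.homDim))) * h x) x *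
          (∫⁻ s : ℝ, H s * ENNReal.ofReal (Real.exp (s * G.homDim))) ∂μ := by
        refine lintegral_congr fun x => ?_
        by_cases hx : x ∈ S
        · have hxD : x ∈ D := hx.1
          rw [indicator_of_mem hx, ← lintegral_add_left_eq_self
            (fun s => H s * ENNReal.ofReal (Real.exp (s * G.homDim))) (σ x),
            ← lintegral_const_mul]
          · refine lintegral_congr fun t => ?_
            rw [hP, indicator_of_mem (hDinv t x hxD), hσt t x hxD, hhinv t x hxD,
              indicator_of_mem hx, mul_one]
            have : ENNReal.ofReal (Real.exp (t * G.homDim)) =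
                ENNReal.ofReal (Real.exp (-(σ x * G.homDim))) *
                  ENNReal.ofReal (Real.exp ((σ x + t) * G.homDim)) := by
              rw [← ENNReal.ofReal_mul (Real.exp_pos _).le, ← Real.exp_add]
              congr 2; ring
            rw [this]; ring
          · refine (hH.comp (measurable_const_add _)).mul ?_
            exact (Real.measurable_exp.comp
              ((measurable_const_add _).mul_const _)).ennreal_ofReal
        · simp [hx]
    _ = _ := by
        rw [lintegral_mul_const _ , lintegral_indicator hSm]
        exact ((Real.measurable_exp.comp (hσ.mul_const _).neg).ennreal_ofReal.mul hh).indicator hSm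

end HomogeneousLieGroup

/-! ### Elementary calculus for the weights and for `|f|^p`. -/

section Calculus

theorem integral_add_mul_add_mul {X : Type*} [MeasurableSpace X] {μ : Measure X} {f g h : X → ℝ}
    (hf : Integrable f μ) (hg : Integrable g μ) (hh : Integrable h μ) (a b : ℝ) :
    ∫ x, f x + a * g x + b * h x ∂μ = (∫ x, f x ∂μ) + a * (∫ x, g x ∂μ) + b * ∫ x, h x ∂μ := by
  have h1 : Integrable (fun x => f x + a * g x) μ := hf.add (hg.const_mul a)
  rw [integral_add h1 (hh.const_mul b), integral_add hf (hg.const_mul a), integral_const_mul,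
    integral_const_mul]

/-- The choice `η = ξ + c u` makes `ξ - η = -c u`, so the pairing with `ξ` becomes the derivative of
a `p`-th power when `u` and `ξ` are a weighted function and its weighted radial derivative. -/
theorem hardyCp_add_smul {p : ℝ} (hp : 1 < p) (ξ u : ℂ) (c : ℝ) :
    hardyCp p ξ (ξ + (c : ℂ) * u) = ‖ξ‖ ^ p + (p - 1) * (|c| ^ p * ‖u‖ ^ p)
      + c * |c| ^ (p - 2) * (p * ‖u‖ ^ (p - 2) * (u * (starRingEnd ℂ) ξ).re) := by
  rw [hardyCp_eq hp]
  have h1 : ξ - (ξ + (c : ℂ) * u) = -((c : ℂ) * u) := by ring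
  have h2 : (-((c : ℂ) * u) * (starRingEnd ℂ) ξ).re = -(c * (u * (starRingEnd ℂ) ξ).re) := by
    rw [neg_mul, Complex.neg_re, mul_assoc, Complex.re_ofReal_mul]
  rw [h1, h2, norm_neg, norm_mul, Complex.norm_real, Real.norm_eq_abs,
    Real.mul_rpow (abs_nonneg _) (norm_nonneg _), Real.mul_rpow (abs_nonneg _) (norm_nonneg _)]
  ring

theorem log_div_pos {R r : ℝ} (hr : 0 < r) (hrR : r < R) : 0 < Real.log (R / r) :=
  Real.log_pos ((one_lt_div hr).2 hrR)

theorem hasDerivAt_log_div_rpow {R r : ℝ} (hr : 0 < r) (hrR : r < R) (s : ℝ) :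
    HasDerivAt (fun r => Real.log (R / r) ^ s) (-(s * Real.log (R / r) ^ (s - 1) / r)) r := by
  have hR : 0 < R := hr.trans hrR
  have hL := log_div_pos hr hrR
  have h1 : HasDerivAt (fun r => Real.log R - Real.log r) (-r⁻¹) r := by
    simpa using (Real.hasDerivAt_log hr.ne').const_sub (Real.log R)
  have h2 : HasDerivAt (fun r => Real.log (R / r)) (-r⁻¹) r := by
    refine h1.congr_of_eventuallyEq ?_
    filter_upwards [lt_mem_nhds hr] with q hq
    rw [Real.log_div hR.ne' (ne_of_gt hq)]
  convert! h2.rpow_const (p := s) (Or.inl hL.ne') using 1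
  field_simp

theorem norm_div_rpow_rpow {p a b : ℝ} (hp : p ≠ 0) (ha : 0 < a) (hb : 0 < b) (s t : ℝ) (z : ℂ) :
    ‖z / ((a ^ (s / p) * b ^ (t / p) : ℝ) : ℂ)‖ ^ p = ‖z‖ ^ p * (a ^ s * b ^ t)⁻¹ := by
  have h1 : 0 < a ^ (s / p) := Real.rpow_pos_of_pos ha _
  have h2 : 0 < b ^ (t / p) := Real.rpow_pos_of_pos hb _
  rw [norm_div, Complex.norm_real, Real.norm_of_nonneg (mul_pos h1 h2).le,
    Real.div_rpow (norm_nonneg _) (mul_pos h1 h2).le, Real.mul_rpow h1.le h2.le,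
    ← Real.rpow_mul ha.le, ← Real.rpow_mul hb.le, div_mul_cancel₀ _ hp, div_mul_cancel₀ _ hp,
    div_eq_mul_inv]

theorem re_div_mul_conj_div (z w : ℂ) (a b : ℝ) :
    (z / (a : ℂ) * (starRingEnd ℂ) (w / (b : ℂ))).re = (z * (starRingEnd ℂ) w).re / (a * b) := by
  rw [map_div₀, Complex.conj_ofReal, div_mul_div_comm, ← Complex.ofReal_mul, Complex.div_ofReal_re]

theorem fderiv_norm_rpow_apply {E : Type*} [NormedAddCommGroup E] [NormedSpace ℝ E] {f : E → ℂ}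
    (hf : Differentiable ℝ f) {p : ℝ} (hp : 1 < p) (x v : E) :
    fderiv ℝ (fun x => ‖f x‖ ^ p) x v =
      p * ‖f x‖ ^ (p - 2) * (f x * (starRingEnd ℂ) (fderiv ℝ f x v)).re := by
  rw [hf.fderiv_norm_rpow hp]
  simp [Complex.inner, Complex.mul_re, mul_comm]

end Calculus

/-! ### Quasi-norm, radial derivative and the Hardy identity. -/

namespace HomogeneousLieGroup

variable {V : Type*} [NormedAddCommGroup V] [NormedSpace ℝ V] [Group V] [LieGroup 𝓘(ℝ, V) ∞ V]

namespace QuasiNorm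

variable {G : HomogeneousLieGroup V}

theorem nrm_flow (N : G.QuasiNorm) (t : ℝ) (x : V) :
    N.nrm (G.flow t x) = Real.exp t * N.nrm x := by
  simpa [dil_eq_flow] using N.nrm_dil (Real.exp t) (Real.exp_pos t) x

theorem nrm_pos_iff (N : G.QuasiNorm) {x : V} : 0 < N.nrm x ↔ x ≠ 0 := by
  rw [← G.one_eq_zero, Ne, ← N.nrm_eq_zero_iff, (N.nonneg x).lt_iff_ne, ne_comm]

theorem nrm_zero (N : G.QuasiNorm) : N.nrm 0 = 0 := by
  rw [N.nrm_eq_zero_iff, G.one_eq_zero]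

theorem mem_ball_one (N : G.QuasiNorm) {R : ℝ} {x : V} : x ∈ N.ball 1 R ↔ N.nrm x < R := by
  simp [ball]

theorem mem_puncturedBall (N : G.QuasiNorm) {R : ℝ} {x : V} :
    x ∈ N.puncturedBall R ↔ 0 < N.nrm x ∧ N.nrm x < R := by
  rw [puncturedBall, mem_sdiff, mem_ball_one, mem_singleton_iff, G.one_eq_zero, nrm_pos_iff,
    and_comm]

theorem isOpen_ball_one (N : G.QuasiNorm) (R : ℝ) : IsOpen (N.ball 1 R) := by
  have : N.ball 1 R = {x | N.nrm x < R} := by ext x; exact N.mem_ball_one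
  rw [this]
  exact isOpen_lt N.continuous_nrm continuous_const

theorem isOpen_puncturedBall (N : G.QuasiNorm) (R : ℝ) : IsOpen (N.puncturedBall R) :=
  (N.isOpen_ball_one R).sdiff isClosed_singleton

theorem angular_eq_flow (N : G.QuasiNorm) (x : V) :
    N.angular x = G.flow (-Real.log (N.nrm x)) x := by
  rw [angular, dil_eq_flow, Real.log_inv]

theorem nrm_angular (N : G.QuasiNorm) {x : V} (hx : 0 < N.nrm x) : N.nrm (N.angular x) = 1 := by
  rw [angular_eq_flow, nrm_flow, Real.exp_neg, Real.exp_log hx, inv_mul_cancel₀ hx.ne']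

theorem angularFun_of_pos (N : G.QuasiNorm) (φ : N.sphere → ℂ) {x : V} (hx : 0 < N.nrm x) :
    N.angularFun φ x = φ ⟨N.angular x, N.nrm_angular hx⟩ := by
  rw [angularFun, dif_pos (show N.angular x ∈ N.sphere from N.nrm_angular hx)]

theorem nrm_dil_angular (N : G.QuasiNorm) {x : V} (hx : 0 < N.nrm x) {r : ℝ} (hr : 0 < r) :
    N.nrm (G.dil r (N.angular x)) = r := by
  rw [N.nrm_dil r hr, N.nrm_angular hx, mul_one]

section

variable [FiniteDimensional ℝ V]

theorem angular_flow (N : G.QuasiNorm) (t : ℝ) {x : V} (hx : 0 < N.nrm x) :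
    N.angular (G.flow t x) = N.angular x := by
  rw [angular_eq_flow, angular_eq_flow, nrm_flow, Real.log_mul (Real.exp_pos t).ne' hx.ne',
    Real.log_exp, ← flow_add]
  congr 2; ring

theorem dil_angular (N : G.QuasiNorm) (x : V) :
    G.dil (N.nrm x) (N.angular x) = x := by
  rw [dil_eq_flow, angular_eq_flow, ← flow_add, add_neg_cancel, flow_zero]

theorem angular_dil_angular (N : G.QuasiNorm) {x : V} (hx : 0 < N.nrm x) (r : ℝ) :
    N.angular (G.dil r (N.angular x)) = N.angular x := by
  rw [dil_eq_flow, N.angular_flow _ (by rw [N.nrm_angular hx]; exact one_pos),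
    N.angular_eq_flow x, N.angular_flow _ hx, angular_eq_flow]

end

end QuasiNorm

/-- The derivative of `f` along the generator `A` of the dilations. -/
def euler (G : HomogeneousLieGroup V) (f : V → ℂ) (x : V) : ℂ := fderiv ℝ f x (G.A x)

theorem continuous_euler (G : HomogeneousLieGroup V) {f : V → ℂ} (hf : ContDiff ℝ 1 f) :
    Continuous (G.euler f) :=
  (hf.continuous_fderiv (by simp)).clm_apply G.A.continuous

namespace QuasiNorm

variable {G : HomogeneousLieGroup V}

/-- The weight `|x| ^ (-s) (log (R / |x|)) ^ (-t)`. -/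
def weight (N : G.QuasiNorm) (R s t : ℝ) (x : V) : ℝ :=
  (N.nrm x ^ s * Real.log (R / N.nrm x) ^ t)⁻¹

theorem weight_nonneg (N : G.QuasiNorm) {R s t : ℝ} {x : V} (hx : x ∈ N.puncturedBall R) :
    0 ≤ N.weight R s t x := by
  obtain ⟨h1, h2⟩ := N.mem_puncturedBall.1 hx
  have := log_div_pos h1 h2
  rw [weight]; positivity

theorem continuousAt_weight (N : G.QuasiNorm) {R s t : ℝ} {x : V} (hx : x ∈ N.puncturedBall R) :
    ContinuousAt (N.weight R s t) x := by
  obtain ⟨h1, h2⟩ := N.mem_puncturedBall.1 hx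
  have hL := log_div_pos h1 h2
  have hR := h1.trans h2
  have hN := N.continuous_nrm.continuousAt (x := x)
  refine ContinuousAt.inv₀ ((hN.rpow_const (Or.inl h1.ne')).mul
    (((continuousAt_const.div hN h1.ne').log (div_pos hR h1).ne').rpow_const (Or.inl hL.ne')))
    (mul_pos (Real.rpow_pos_of_pos h1 _) (Real.rpow_pos_of_pos hL _)).ne'

section Support

variable (N : G.QuasiNorm) {R : ℝ} {f : V → ℂ}

/-- The weight is singular only at the origin and at `|x| = R`, and the support of a test function
stays away from both. Hence all the integrands below extend continuously by zero. -/
theorem continuous_mul_weight (hf : f ∈ N.testFunctions R) {g : V → ℝ} (hg : Continuous g)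
    (hg0 : ∀ x ∉ tsupport f, g x = 0) (s t : ℝ) :
    Continuous fun x => g x * N.weight R s t x := by
  rw [continuous_iff_continuousAt]
  intro x
  by_cases hx : x ∈ N.puncturedBall R
  · exact hg.continuousAt.mul (N.continuousAt_weight hx)
  · have hx' : x ∉ tsupport f := fun h => hx (hf.2.2 h)
    have : (fun x => g x * N.weight R s t x) =ᶠ[nhds x] fun _ => 0 := by
      filter_upwards [(isClosed_tsupport f).isOpen_compl.mem_nhds hx'] with y hy
      rw [hg0 y hy, zero_mul]
    exact continuousAt_const.congr this.symm

theorem hasCompactSupport_mul_weight (hf : f ∈ N.testFunctions R) {g : V → ℝ}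
    (hg0 : ∀ x ∉ tsupport f, g x = 0) (s t : ℝ) :
    HasCompactSupport fun x => g x * N.weight R s t x :=
  HasCompactSupport.intro hf.2.1.isCompact fun x hx => by rw [hg0 x hx, zero_mul]

theorem euler_eq_zero_of_notMem_tsupport {x : V} (hx : x ∉ tsupport f) : G.euler f x = 0 := by
  have : fderiv ℝ f x = 0 :=
    image_eq_zero_of_notMem_tsupport fun h => hx (tsupport_fderiv_subset ℝ h)
  rw [euler, this]; rfl

theorem zero_notMem_tsupport (hf : f ∈ N.testFunctions R) : (0 : V) ∉ tsupport f := by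
  intro h
  have := (N.mem_puncturedBall.1 (hf.2.2 h)).1
  rw [N.nrm_zero] at this
  exact lt_irrefl _ this

end Support

theorem contDiff_one_of_mem (N : G.QuasiNorm) {R : ℝ} {f : V → ℂ} (hf : f ∈ N.testFunctions R) :
    ContDiff ℝ 1 f := hf.1.of_le (by exact_mod_cast le_top)

theorem differentiable_of_mem (N : G.QuasiNorm) {R : ℝ} {f : V → ℂ}
    (hf : f ∈ N.testFunctions R) : Differentiable ℝ f := hf.1.differentiable (by simp)

section Identity

variable (N : G.QuasiNorm) {p α β R : ℝ} {f : V → ℂ}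

theorem norm_hardyTerm_rpow (hp : 1 < p) {x : V} (hx : x ∈ N.puncturedBall R) :
    ‖N.hardyTerm p α β R f x‖ ^ p = ‖f x‖ ^ p * N.weight R (α + p) (β + p + 1) x := by
  obtain ⟨h1, h2⟩ := N.mem_puncturedBall.1 hx
  exact norm_div_rpow_rpow (by linarith) h1 (log_div_pos h1 h2) _ _ _

variable [FiniteDimensional ℝ V]

/-- The curve `r ↦ exp (log r • A) y` has velocity `r⁻¹ A (D_r y)`, whence `|x| ℛf = E f`. -/
theorem hasDerivAt_radial (N : G.QuasiNorm) {f : V → ℂ} (hf : Differentiable ℝ f) {x : V}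
    (hx : 0 < N.nrm x) :
    HasDerivAt (fun r : ℝ => f (G.dil r (N.angular x))) (G.euler f x / (N.nrm x : ℂ))
      (N.nrm x) := by
  have h1 := (G.hasDerivAt_flow (Real.log (N.nrm x)) (N.angular x)).scomp (N.nrm x)
    (Real.hasDerivAt_log hx.ne')
  rw [← dil_eq_flow, N.dil_angular x] at h1
  have h2 : HasFDerivAt f (fderiv ℝ f x) (G.dil (N.nrm x) (N.angular x)) := by
    rw [N.dil_angular x]; exact (hf x).hasFDerivAt
  have h3 := h2.comp_hasDerivAt (N.nrm x) h1
  convert! h3 using 1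
  rw [map_smul, euler, Complex.real_smul, Complex.ofReal_inv, div_eq_inv_mul]

theorem radialDeriv_eq (N : G.QuasiNorm) {f : V → ℂ} (hf : Differentiable ℝ f) (x : V) :
    N.radialDeriv f x = G.euler f x / (N.nrm x : ℂ) := by
  rcases (N.nonneg x).eq_or_lt with h | h
  · have hx : x = 0 := by
      by_contra hne
      exact (N.nrm_pos_iff.2 hne).ne h
    subst hx
    simp [radialDeriv, angular, euler]
  · exact (N.hasDerivAt_radial hf h).deriv

theorem norm_radialTerm_rpow (hp : 1 < p) (hf : Differentiable ℝ f) {x : V}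
    (hx : x ∈ N.puncturedBall R) :
    ‖N.radialTerm p α β R f x‖ ^ p = ‖G.euler f x‖ ^ p * N.weight R (α + p) (β + 1) x := by
  obtain ⟨h1, h2⟩ := N.mem_puncturedBall.1 hx
  rw [radialTerm, norm_div_rpow_rpow (by linarith) h1 (log_div_pos h1 h2), N.radialDeriv_eq hf,
    norm_div, Complex.norm_real, Real.norm_of_nonneg h1.le,
    Real.div_rpow (norm_nonneg _) h1.le, weight, Real.rpow_add h1]
  simp only [mul_inv]
  ring

/-- Chain rule for `|f|^p` along `A x`; the weights of `u` (to the power `p - 1`) and of `ξ` combine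
into the single weight with exponents `α + p` and `β + p`. -/
theorem cross_eq (hp : 1 < p) (hf : Differentiable ℝ f) {x : V}
    (hx : x ∈ N.puncturedBall R) :
    p * ‖N.hardyTerm p α β R f x‖ ^ (p - 2) *
        (N.hardyTerm p α β R f x * (starRingEnd ℂ) (N.radialTerm p α β R f x)).re =
      fderiv ℝ (fun x => ‖f x‖ ^ p) x (G.A x) * N.weight R (α + p) (β + p) x := by
  obtain ⟨h1, h2⟩ := N.mem_puncturedBall.1 hx
  have hL := log_div_pos h1 h2
  have hp0 : p ≠ 0 := by linarith
  rw [hardyTerm, radialTerm, N.radialDeriv_eq hf, div_div, ← Complex.ofReal_mul,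
    re_div_mul_conj_div, fderiv_norm_rpow_apply hf hp, weight, ← euler]
  set n := N.nrm x
  set L := Real.log (R / n)
  set a := n ^ ((α + p) / p) * L ^ ((β + p + 1) / p) with ha
  have ha0 : 0 < a := mul_pos (Real.rpow_pos_of_pos h1 _) (Real.rpow_pos_of_pos hL _)
  rw [norm_div, Complex.norm_real, Real.norm_of_nonneg ha0.le,
    Real.div_rpow (norm_nonneg _) ha0.le]
  have key : a ^ (p - 2) * (a * (n * (n ^ (α / p) * L ^ ((β + 1) / p)))) =
      n ^ (α + p) * L ^ (β + p) := by
    rw [← mul_assoc, rpow_sub_two_mul_self hp ha0.le, ha,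
      Real.mul_rpow (Real.rpow_pos_of_pos h1 _).le (Real.rpow_pos_of_pos hL _).le,
      ← Real.rpow_mul h1.le, ← Real.rpow_mul hL.le]
    -- The first factor collects `p - 1` powers of the weight of `u`; the additional 1 comes from
    -- `ℛf = E f / |x|`.
    have e1 : α + p = (α + p) / p * (p - 1) + (1 + α / p) := by field_simp; ring
    have e2 : β + p = (β + p + 1) / p * (p - 1) + (β + 1) / p := by field_simp; ring
    conv_rhs => rw [e1, e2, Real.rpow_add h1, Real.rpow_add h1, Real.rpow_add hL, Real.rpow_one]
    ring
  rw [← key]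
  have ha2 : a ^ (p - 2) ≠ 0 := (Real.rpow_pos_of_pos ha0 _).ne'
  simp only [mul_inv, div_eq_mul_inv]
  ring

/-- The remainder density on the quasi-ball, as a combination of continuous functions. -/
theorem remainder_eq (hp : 1 < p) (hf : f ∈ N.testFunctions R) {x : V} (hx : x ∈ N.ball 1 R) :
    N.remainder p α β R f x = ‖G.euler f x‖ ^ p * N.weight R (α + p) (β + 1) x
      + (p - 1) * |(β + p) / p| ^ p * (‖f x‖ ^ p * N.weight R (α + p) (β + p + 1) x)
      + (β + p) / p * |(β + p) / p| ^ (p - 2) *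
        (fderiv ℝ (fun x => ‖f x‖ ^ p) x (G.A x) * N.weight R (α + p) (β + p) x) := by
  have hd := N.differentiable_of_mem hf
  rw [remainder, hardyCp_add_smul hp]
  by_cases h : x = 0
  · subst h
    have h0 : f 0 = 0 := image_eq_zero_of_notMem_tsupport (N.zero_notMem_tsupport hf)
    have h1 : G.euler f 0 = 0 := by simp [euler]
    simp [hardyTerm, radialTerm, N.radialDeriv_eq hd, h0, h1, Real.zero_rpow (by linarith : p ≠ 0)]
  · have hU : x ∈ N.puncturedBall R :=
      N.mem_puncturedBall.2 ⟨N.nrm_pos_iff.2 h, N.mem_ball_one.1 hx⟩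
    rw [N.cross_eq hp hd hU, N.norm_hardyTerm_rpow hp hU, N.norm_radialTerm_rpow hp hd hU]
    ring

theorem norm_hardyTerm_rpow' (hp : 1 < p) (hf : f ∈ N.testFunctions R) {x : V}
    (hx : x ∈ N.ball 1 R) :
    ‖N.hardyTerm p α β R f x‖ ^ p = ‖f x‖ ^ p * N.weight R (α + p) (β + p + 1) x := by
  by_cases h : x = 0
  · subst h
    have h0 : f 0 = 0 := image_eq_zero_of_notMem_tsupport (N.zero_notMem_tsupport hf)
    simp [hardyTerm, h0, Real.zero_rpow (by linarith : p ≠ 0)]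
  · exact N.norm_hardyTerm_rpow hp
      (N.mem_puncturedBall.2 ⟨N.nrm_pos_iff.2 h, N.mem_ball_one.1 hx⟩)

theorem norm_radialTerm_rpow' (hp : 1 < p) (hf : f ∈ N.testFunctions R) {x : V}
    (hx : x ∈ N.ball 1 R) :
    ‖N.radialTerm p α β R f x‖ ^ p = ‖G.euler f x‖ ^ p * N.weight R (α + p) (β + 1) x := by
  have hd := N.differentiable_of_mem hf
  by_cases h : x = 0
  · subst h
    have h1 : G.euler f 0 = 0 := by simp [euler]
    simp [radialTerm, N.radialDeriv_eq hd, h1, Real.zero_rpow (by linarith : p ≠ 0)]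
  · exact N.norm_radialTerm_rpow hp hd
      (N.mem_puncturedBall.2 ⟨N.nrm_pos_iff.2 h, N.mem_ball_one.1 hx⟩)

/-- Along the dilations `|x|` is multiplied by `e^τ` and `L` decreases at unit speed, so `E |x|^(-s)
= -s |x|^(-s)` and `E L^(-t) = t L^(-t-1)`. No smoothness of the quasi-norm is involved. -/
theorem hasDerivAt_weight_flow (s t : ℝ) {x : V} (hx : x ∈ N.puncturedBall R) :
    HasDerivAt (fun τ => N.weight R s t (G.flow τ x))
      (-s * N.weight R s t x + t * N.weight R s (t + 1) x) 0 := by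
  obtain ⟨h1, h2⟩ := N.mem_puncturedBall.1 hx
  have hL := log_div_pos h1 h2
  have hn : HasDerivAt (fun τ => N.nrm (G.flow τ x)) (N.nrm x) 0 := by
    simp_rw [nrm_flow]
    simpa using (Real.hasDerivAt_exp 0).mul_const (N.nrm x)
  have e0 : N.nrm x = N.nrm (G.flow 0 x) := by rw [flow_zero]
  have hw : HasDerivAt (fun r => (r ^ s * Real.log (R / r) ^ t)⁻¹) (-(s * N.nrm x ^ (s - 1) *
      Real.log (R / N.nrm x) ^ t + N.nrm x ^ s * -(t * Real.log (R / N.nrm x) ^ (t - 1) / N.nrm x))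
      / (N.nrm x ^ s * Real.log (R / N.nrm x) ^ t) ^ 2) (N.nrm x) :=
    ((Real.hasDerivAt_rpow_const (Or.inl h1.ne')).mul (hasDerivAt_log_div_rpow h1 h2 t)).inv
      (mul_pos (Real.rpow_pos_of_pos h1 _) (Real.rpow_pos_of_pos hL _)).ne'
  rw [e0] at hw
  have := hw.comp (0 : ℝ) hn
  rw [← e0] at this
  convert! this using 1
  rw [weight, weight, Real.rpow_sub_one h1.ne', Real.rpow_sub_one hL.ne', Real.rpow_add_one hL.ne']
  have := (Real.rpow_pos_of_pos h1 s).ne'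
  have := (Real.rpow_pos_of_pos hL t).ne'
  have := hL.ne'
  have := h1.ne'
  field_simp
  ring

variable [MeasurableSpace V] [BorelSpace V] (μ : Measure V) [μ.IsHaarMeasure]

theorem integral_ball_eq {g h : V → ℝ} (hgh : ∀ x ∈ N.ball 1 R, g x = h x)
    (hh : ∀ x ∉ N.ball 1 R, h x = 0) : ∫ x in N.ball 1 R, g x ∂μ = ∫ x, h x ∂μ := by
  rw [setIntegral_congr_fun (N.isOpen_ball_one R).measurableSet hgh,
    setIntegral_eq_integral_of_forall_compl_eq_zero hh]

theorem notMem_tsupport_of_notMem_ball (hf : f ∈ N.testFunctions R) {x : V}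
    (hx : x ∉ N.ball 1 R) : x ∉ tsupport f := fun h => hx (hf.2.2 h).1

theorem norm_rpow_eq_zero (hp : 1 < p) : ∀ x ∉ tsupport f, ‖f x‖ ^ p = 0 := fun x hx => by
  rw [image_eq_zero_of_notMem_tsupport hx, norm_zero, Real.zero_rpow (by linarith)]

theorem norm_euler_rpow_eq_zero (hp : 1 < p) : ∀ x ∉ tsupport f, ‖G.euler f x‖ ^ p = 0 :=
  fun x hx => by
    rw [euler_eq_zero_of_notMem_tsupport hx, norm_zero, Real.zero_rpow (by linarith)]

theorem fderiv_norm_rpow_eq_zero (hp : 1 < p) (hf : Differentiable ℝ f) :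
    ∀ x ∉ tsupport f, fderiv ℝ (fun x => ‖f x‖ ^ p) x (G.A x) = 0 := fun x hx => by
  rw [fderiv_norm_rpow_apply hf hp, image_eq_zero_of_notMem_tsupport hx, zero_mul,
    Complex.zero_re, mul_zero]

theorem continuous_fderiv_norm_rpow (hp : 1 < p) (hf : ContDiff ℝ 1 f) :
    Continuous fun x => fderiv ℝ (fun x => ‖f x‖ ^ p) x (G.A x) :=
  ((hf.norm_rpow hp).continuous_fderiv (by simp)).clm_apply G.A.continuous

theorem integrable_mul_weight (hf : f ∈ N.testFunctions R) {g : V → ℝ} (hg : Continuous g)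
    (hg0 : ∀ x ∉ tsupport f, g x = 0) (s t : ℝ) :
    Integrable (fun x => g x * N.weight R s t x) μ :=
  (N.continuous_mul_weight hf hg hg0 s t).integrable_of_hasCompactSupport
    (N.hasCompactSupport_mul_weight hf hg0 s t)

theorem continuous_norm_rpow (hp : 1 < p) (hf : f ∈ N.testFunctions R) :
    Continuous fun x => ‖f x‖ ^ p :=
  hf.1.continuous.norm.rpow_const fun _ => Or.inr (by linarith)

theorem continuous_norm_euler_rpow (hp : 1 < p) (hf : f ∈ N.testFunctions R) :
    Continuous fun x => ‖G.euler f x‖ ^ p :=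
  (G.continuous_euler (N.contDiff_one_of_mem hf)).norm.rpow_const fun _ => Or.inr (by linarith)

/-- The divergence theorem for the weighted field, which produces the Hardy identity. -/
theorem integral_cross (hp : 1 < p) (hf : f ∈ N.testFunctions R) :
    ∫ x, fderiv ℝ (fun x => ‖f x‖ ^ p) x (G.A x) * N.weight R (α + p) (β + p) x ∂μ =
      -(G.homDim - α - p) * (∫ x, ‖f x‖ ^ p * N.weight R (α + p) (β + p) x ∂μ)
      - (β + p) * ∫ x, ‖f x‖ ^ p * N.weight R (α + p) (β + p + 1) x ∂μ := by
  have hd := N.differentiable_of_mem hf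
  have hc := N.contDiff_one_of_mem hf
  have h0 := norm_rpow_eq_zero (f := f) hp
  have hcp := N.continuous_norm_rpow hp hf
  have hY0 := fderiv_norm_rpow_eq_zero (G := G) hp hd
  have hYc := continuous_fderiv_norm_rpow (G := G) hp hc
  have iW := N.integrable_mul_weight μ hf hcp h0 (α + p) (β + p)
  have iU := N.integrable_mul_weight μ hf hcp h0 (α + p) (β + p + 1)
  have iY := N.integrable_mul_weight μ hf hYc hY0 (α + p) (β + p)
  have key := G.integral_deriv_flow μ
    (F := fun x => ‖f x‖ ^ p * N.weight R (α + p) (β + p) x)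
    (F' := fun x => fderiv ℝ (fun x => ‖f x‖ ^ p) x (G.A x) * N.weight R (α + p) (β + p) x
      + (-(α + p) * (‖f x‖ ^ p * N.weight R (α + p) (β + p) x)
        + (β + p) * (‖f x‖ ^ p * N.weight R (α + p) (β + p + 1) x)))
    (N.continuous_mul_weight hf hcp h0 _ _) (N.hasCompactSupport_mul_weight hf h0 _ _)
    ((N.continuous_mul_weight hf hYc hY0 _ _).add
      ((continuous_const.mul (N.continuous_mul_weight hf hcp h0 _ _)).add
        (continuous_const.mul (N.continuous_mul_weight hf hcp h0 _ _))))
    (HasCompactSupport.intro hf.2.1.isCompact fun x hx => by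
      simp only [hY0 x hx, h0 x hx, zero_mul, mul_zero, add_zero])
    (fun x => by
      by_cases hx : x ∈ N.puncturedBall R
      · have h1 : HasFDerivAt (fun x => ‖f x‖ ^ p) (fderiv ℝ (fun x => ‖f x‖ ^ p) x)
            (G.flow 0 x) := by
          rw [flow_zero]
          exact (hd.norm_rpow hp x).hasFDerivAt
        have h2 := h1.comp_hasDerivAt (0 : ℝ) (G.hasDerivAt_flow 0 x)
        have h3 := h2.mul (N.hasDerivAt_weight_flow (α + p) (β + p) hx)
        rw [flow_zero] at h3
        convert! h3 using 1
        simp only [Function.comp_apply, flow_zero]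
        ring
      -- Outside the punctured ball the weight need not be differentiable, but for small `t` the
      -- dilated point avoids the support and the product is identically zero.
      · have hx' : x ∉ tsupport f := fun h => hx (hf.2.2 h)
        have hev : (fun t => ‖f (G.flow t x)‖ ^ p * N.weight R (α + p) (β + p) (G.flow t x))
            =ᶠ[nhds 0] fun _ => 0 := by
          have hcont : Continuous fun t : ℝ => G.flow t x :=
            G.continuous_flow.comp (continuous_id.prodMk continuous_const)
          have : (tsupport f)ᶜ ∈ nhds (G.flow 0 x) := by
            rw [flow_zero]; exact (isClosed_tsupport f).isOpen_compl.mem_nhds hx'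
          filter_upwards [hcont.continuousAt.preimage_mem_nhds this] with t ht
          rw [h0 _ ht, zero_mul]
        simp only [hY0 x hx', h0 x hx', zero_mul, mul_zero, add_zero]
        exact (hasDerivAt_const (0 : ℝ) (0 : ℝ)).congr_of_eventuallyEq hev)
  simp only [← add_assoc] at key
  rw [integral_add_mul_add_mul iY iW iU] at key
  linarith

theorem integral_hardyTerm (hp : 1 < p) (hf : f ∈ N.testFunctions R) :
    ∫ x in N.ball 1 R, ‖N.hardyTerm p α β R f x‖ ^ p ∂μ =
      ∫ x, ‖f x‖ ^ p * N.weight R (α + p) (β + p + 1) x ∂μ :=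
  N.integral_ball_eq μ (fun _ hx => N.norm_hardyTerm_rpow' hp hf hx) fun x hx => by
    rw [norm_rpow_eq_zero hp x (N.notMem_tsupport_of_notMem_ball hf hx), zero_mul]

theorem integral_radialTerm (hp : 1 < p) (hf : f ∈ N.testFunctions R) :
    ∫ x in N.ball 1 R, ‖N.radialTerm p α β R f x‖ ^ p ∂μ =
      ∫ x, ‖G.euler f x‖ ^ p * N.weight R (α + p) (β + 1) x ∂μ :=
  N.integral_ball_eq μ (fun _ hx => N.norm_radialTerm_rpow' hp hf hx) fun x hx => by
    rw [norm_euler_rpow_eq_zero hp x (N.notMem_tsupport_of_notMem_ball hf hx), zero_mul]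

theorem integral_middle (hp : 1 < p) (hf : f ∈ N.testFunctions R) :
    ∫ x in N.ball 1 R, ‖f x‖ ^ p /
        (N.nrm x ^ (α + p) * Real.log (R / N.nrm x) ^ (β + p)) ∂μ =
      ∫ x, ‖f x‖ ^ p * N.weight R (α + p) (β + p) x ∂μ :=
  N.integral_ball_eq μ (fun _ _ => div_eq_mul_inv _ _) fun x hx => by
    rw [norm_rpow_eq_zero hp x (N.notMem_tsupport_of_notMem_ball hf hx), zero_mul]

/-- The continuous extension by zero of the remainder density. -/
def remainderExt (p α β R : ℝ) (f : V → ℂ) (x : V) : ℝ :=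
  ‖G.euler f x‖ ^ p * N.weight R (α + p) (β + 1) x
      + (p - 1) * |(β + p) / p| ^ p * (‖f x‖ ^ p * N.weight R (α + p) (β + p + 1) x)
      + (β + p) / p * |(β + p) / p| ^ (p - 2) *
        (fderiv ℝ (fun x => ‖f x‖ ^ p) x (G.A x) * N.weight R (α + p) (β + p) x)

theorem remainderExt_eq_zero (hp : 1 < p) (hf : f ∈ N.testFunctions R) {x : V}
    (hx : x ∉ tsupport f) : N.remainderExt p α β R f x = 0 := by
  simp only [remainderExt, norm_euler_rpow_eq_zero hp x hx, norm_rpow_eq_zero hp x hx,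
    fderiv_norm_rpow_eq_zero hp (N.differentiable_of_mem hf) x hx, zero_mul, mul_zero, add_zero]

theorem continuous_remainderExt (hp : 1 < p) (hf : f ∈ N.testFunctions R) :
    Continuous (N.remainderExt p α β R f) := by
  have hc := N.contDiff_one_of_mem hf
  refine ((N.continuous_mul_weight hf (N.continuous_norm_euler_rpow hp hf)
    (norm_euler_rpow_eq_zero hp) _ _).add (continuous_const.mul
    (N.continuous_mul_weight hf (N.continuous_norm_rpow hp hf) (norm_rpow_eq_zero hp) _ _))).add
    (continuous_const.mul (N.continuous_mul_weight hf (continuous_fderiv_norm_rpow hp hc)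
    (fderiv_norm_rpow_eq_zero hp (N.differentiable_of_mem hf)) _ _))

theorem integrable_remainderExt (hp : 1 < p) (hf : f ∈ N.testFunctions R) :
    Integrable (N.remainderExt p α β R f) μ :=
  (N.continuous_remainderExt hp hf).integrable_of_hasCompactSupport
    (HasCompactSupport.intro hf.2.1.isCompact fun _ hx => N.remainderExt_eq_zero hp hf hx)

theorem integral_remainder (hp : 1 < p) (hf : f ∈ N.testFunctions R) :
    ∫ x in N.ball 1 R, N.remainder p α β R f x ∂μ = ∫ x, N.remainderExt p α β R f x ∂μ :=
  N.integral_ball_eq μ (fun _ hx => N.remainder_eq hp hf hx) fun _ hx =>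
    N.remainderExt_eq_zero hp hf (N.notMem_tsupport_of_notMem_ball hf hx)

theorem integrableOn_ball {g h : V → ℝ} (hgh : ∀ x ∈ N.ball 1 R, g x = h x)
    (hh : Integrable h μ) : IntegrableOn g (N.ball 1 R) μ :=
  hh.integrableOn.congr_fun (fun x hx => (hgh x hx).symm) (N.isOpen_ball_one R).measurableSet

theorem integrable_all (hp : 1 < p) (hf : f ∈ N.testFunctions R) :
    IntegrableOn (fun x => ‖N.hardyTerm p α β R f x‖ ^ p) (N.ball 1 R) μ ∧
      IntegrableOn (fun x => ‖N.radialTerm p α β R f x‖ ^ p) (N.ball 1 R) μ ∧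
      IntegrableOn (fun x => ‖f x‖ ^ p /
        (N.nrm x ^ (α + p) * Real.log (R / N.nrm x) ^ (β + p))) (N.ball 1 R) μ ∧
      IntegrableOn (fun x => N.remainder p α β R f x) (N.ball 1 R) μ := by
  have hcp := N.continuous_norm_rpow hp hf
  have h0 := norm_rpow_eq_zero (f := f) hp
  exact ⟨N.integrableOn_ball μ (fun _ hx => N.norm_hardyTerm_rpow' hp hf hx)
      (N.integrable_mul_weight μ hf hcp h0 _ _),
    N.integrableOn_ball μ (fun _ hx => N.norm_radialTerm_rpow' hp hf hx)
      (N.integrable_mul_weight μ hf (N.continuous_norm_euler_rpow hp hf)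
        (norm_euler_rpow_eq_zero hp) _ _),
    N.integrableOn_ball μ (fun _ _ => div_eq_mul_inv _ _)
      (N.integrable_mul_weight μ hf hcp h0 _ _),
    N.integrableOn_ball μ (fun _ hx => N.remainder_eq hp hf hx)
      (N.integrable_remainderExt μ hp hf)⟩

/-- The Hardy identity with remainder. -/
theorem hardy_identity (hp : 1 < p) (hf : f ∈ N.testFunctions R) :
    |(β + p) / p| ^ p * ∫ x in N.ball 1 R, ‖N.hardyTerm p α β R f x‖ ^ p ∂μ =
      (∫ x in N.ball 1 R, ‖N.radialTerm p α β R f x‖ ^ p ∂μ)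
      - (G.homDim - α - p) * ((β + p) / p) * |(β + p) / p| ^ (p - 2) *
        (∫ x in N.ball 1 R, ‖f x‖ ^ p /
          (N.nrm x ^ (α + p) * Real.log (R / N.nrm x) ^ (β + p)) ∂μ)
      - ∫ x in N.ball 1 R, N.remainder p α β R f x ∂μ := by
  have hd := N.differentiable_of_mem hf
  have hc := N.contDiff_one_of_mem hf
  have hcp := N.continuous_norm_rpow hp hf
  have h0 := norm_rpow_eq_zero (f := f) hp
  have iU := N.integrable_mul_weight μ hf hcp h0 (α + p) (β + p + 1)
  have iX := N.integrable_mul_weight μ hf (N.continuous_norm_euler_rpow hp hf)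
    (norm_euler_rpow_eq_zero hp) (α + p) (β + 1)
  have iY := N.integrable_mul_weight μ hf (continuous_fderiv_norm_rpow (G := G) hp hc)
    (fderiv_norm_rpow_eq_zero hp hd) (α + p) (β + p)
  have hrem : ∫ x, N.remainderExt p α β R f x ∂μ =
      (∫ x, ‖G.euler f x‖ ^ p * N.weight R (α + p) (β + 1) x ∂μ)
      + (p - 1) * |(β + p) / p| ^ p * (∫ x, ‖f x‖ ^ p * N.weight R (α + p) (β + p + 1) x ∂μ)
      + (β + p) / p * |(β + p) / p| ^ (p - 2) *
        ∫ x, fderiv ℝ (fun x => ‖f x‖ ^ p) x (G.A x) * N.weight R (α + p) (β + p) x ∂μ := by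
    simp only [remainderExt]
    exact integral_add_mul_add_mul iX iU iY _ _
  rw [N.integral_hardyTerm μ hp hf, N.integral_radialTerm μ hp hf, N.integral_middle μ hp hf,
    N.integral_remainder μ hp hf, hrem, N.integral_cross μ hp hf]
  have hsq := rpow_sub_two_mul_sq hp (abs_nonneg ((β + p) / p))
  rw [sq_abs] at hsq
  -- With `|c|^p = |c|^(p-2) c²`, the coefficient of `∫ |u|^p` is `(p - 1)|c|^p - p |c|^p = -|c|^p`.
  -- For `β = -p` the explicit factor `c = 0` kills the middle term, whatever `|c|^(p-2)` is.
  have hb : β + p = (β + p) / p * p := by field_simp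
  set c := (β + p) / p
  rw [← hsq]
  generalize (∫ x, ‖f x‖ ^ p * N.weight R (α + p) (β + p + 1) x ∂μ) = U
  generalize (∫ x, ‖f x‖ ^ p * N.weight R (α + p) (β + p) x ∂μ) = W
  rw [hb]
  ring

/-- In the identity the two subtracted terms are nonnegative: the remainder by positivity of `C_p`,
the middle term by the sign condition. -/
theorem hardy_inequality (hp : 1 < p) (h : 0 ≤ (G.homDim - α - p) * (β + p))
    (hf : f ∈ N.testFunctions R) :
    |(β + p) / p| ^ p * ∫ x in N.ball 1 R, ‖N.hardyTerm p α β R f x‖ ^ p ∂μ ≤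
      ∫ x in N.ball 1 R, ‖N.radialTerm p α β R f x‖ ^ p ∂μ := by
  have h1 : 0 ≤ ∫ x in N.ball 1 R, N.remainder p α β R f x ∂μ :=
    integral_nonneg fun _ => hardyCp_nonneg hp _ _
  have h2 : 0 ≤ ∫ x in N.ball 1 R, ‖f x‖ ^ p /
      (N.nrm x ^ (α + p) * Real.log (R / N.nrm x) ^ (β + p)) ∂μ := by
    rw [N.integral_middle μ hp hf]
    refine integral_nonneg fun x => ?_
    by_cases hx : x ∈ N.puncturedBall R
    · exact mul_nonneg (Real.rpow_nonneg (norm_nonneg _) _) (N.weight_nonneg hx)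
    · simp only [norm_rpow_eq_zero hp x fun h => hx (hf.2.2 h), zero_mul]
      exact le_rfl
  have h3 : 0 ≤ (G.homDim - α - p) * ((β + p) / p) * |(β + p) / p| ^ (p - 2) := by
    refine mul_nonneg ?_ (Real.rpow_nonneg (abs_nonneg _) _)
    rw [← mul_div_assoc]
    exact div_nonneg h (by linarith)
  rw [N.hardy_identity μ hp hf]
  have := mul_nonneg h3 h2
  linarith

end Identity

end QuasiNorm
end HomogeneousLieGroup

/-! ### Vanishing of the remainder and the extremal functions. -/

namespace HomogeneousLieGroup.QuasiNorm

variable {V : Type*} [NormedAddCommGroup V] [NormedSpace ℝ V] [Group V] [LieGroup 𝓘(ℝ, V) ∞ V]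
  {G : HomogeneousLieGroup V} [FiniteDimensional ℝ V]

section Extremal

variable (N : G.QuasiNorm) {p α β R : ℝ} {f : V → ℂ}

/-- The remainder vanishes only for `η = 0`; clearing the common weight leaves the linear equation
`ℛf = -c f / (r L)` on each orbit. -/
theorem remainder_eq_zero_iff (hp : 1 < p) {x : V} (hx : x ∈ N.puncturedBall R) :
    N.remainder p α β R f x = 0 ↔
      N.radialDeriv f x =
        -((((β + p) / p / (N.nrm x * Real.log (R / N.nrm x)) : ℝ) : ℂ) * f x) := by
  obtain ⟨h1, h2⟩ := N.mem_puncturedBall.1 hx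
  have hL := log_div_pos h1 h2
  have hp0 : p ≠ 0 := by linarith
  rw [remainder, hardyCp_eq_zero_iff hp, radialTerm, hardyTerm, add_div α, div_self hp0,
    Real.rpow_add h1, Real.rpow_one, add_right_comm β p 1, add_div (β + 1), div_self hp0,
    Real.rpow_add hL, Real.rpow_one]
  have ha : ((N.nrm x ^ (α / p) : ℝ) : ℂ) ≠ 0 := by
    exact_mod_cast (Real.rpow_pos_of_pos h1 _).ne'
  have hb : ((Real.log (R / N.nrm x) ^ ((β + 1) / p) : ℝ) : ℂ) ≠ 0 := by
    exact_mod_cast (Real.rpow_pos_of_pos hL _).ne'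
  have hn : ((N.nrm x : ℝ) : ℂ) ≠ 0 := by exact_mod_cast h1.ne'
  have hl : ((Real.log (R / N.nrm x) : ℝ) : ℂ) ≠ 0 := by exact_mod_cast hL.ne'
  have hpc : (p : ℂ) ≠ 0 := by exact_mod_cast hp0
  generalize N.radialDeriv f x = D
  push_cast
  rw [eq_neg_iff_add_eq_zero]
  have e : D / (((N.nrm x ^ (α / p) : ℝ) : ℂ) * ((Real.log (R / N.nrm x) ^ ((β + 1) / p) : ℝ) : ℂ))
      + ((β : ℂ) + p) / p * (f x / (((N.nrm x ^ (α / p) : ℝ) : ℂ) * (N.nrm x : ℂ) *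
        (((Real.log (R / N.nrm x) ^ ((β + 1) / p) : ℝ) : ℂ) * (Real.log (R / N.nrm x) : ℂ)))) =
      (D + ((β : ℂ) + p) / p / ((N.nrm x : ℂ) * (Real.log (R / N.nrm x) : ℂ)) * f x) /
      (((N.nrm x ^ (α / p) : ℝ) : ℂ) * ((Real.log (R / N.nrm x) ^ ((β + 1) / p) : ℝ) : ℂ)) := by
    field_simp
  rw [e, div_eq_zero_iff, or_iff_left (mul_ne_zero ha hb)]

theorem dil_angular_mem (hx : 0 < N.nrm x) {r : ℝ} (hr : r ∈ Ioo 0 R) :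
    G.dil r (N.angular x) ∈ N.puncturedBall R := by
  rw [mem_puncturedBall, N.nrm_dil_angular hx hr.1]
  exact hr

theorem extremal_eq (φ : N.sphere → ℂ) {x : V} (hx : 0 < N.nrm x) :
    N.extremal p β R φ x = ((Real.log (R / N.nrm x) ^ ((β + p) / p) : ℝ) : ℂ) *
      φ ⟨N.angular x, N.nrm_angular hx⟩ := by
  rw [extremal, N.angularFun_of_pos φ hx]

theorem hasDerivAt_radial_dil {x : V} (hx : 0 < N.nrm x) {r : ℝ} (hr : r ∈ Ioo 0 R)
    (hf : N.RadialDifferentiableAt f (G.dil r (N.angular x))) :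
    HasDerivAt (fun s : ℝ => f (G.dil s (N.angular x)))
      (N.radialDeriv f (G.dil r (N.angular x))) r := by
  rw [RadialDifferentiableAt, N.angular_dil_angular hx, N.nrm_dil_angular hx hr.1] at hf
  rw [radialDeriv, N.angular_dil_angular hx, N.nrm_dil_angular hx hr.1]
  exact hf.hasDerivAt

theorem exists_extremal_of_remainder_eq_zero (hp : 1 < p)
    (hf : ∀ x ∈ N.puncturedBall R, N.RadialDifferentiableAt f x)
    (h : ∀ x ∈ N.puncturedBall R, N.remainder p α β R f x = 0) :
    ∃ φ : N.sphere → ℂ, ∀ x ∈ N.puncturedBall R, f x = N.extremal p β R φ x := by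
  set c := (β + p) / p with hc
  -- On each orbit `L^(-c) f` has derivative zero on the interval `(0, R)`, hence is constant. Its
  -- value is read off at `R / 2`, an arbitrary radius in that interval.
  refine ⟨fun y => ((Real.log (R / (R / 2)) ^ (-c) : ℝ) : ℂ) * f (G.dil (R / 2) y), fun x hx => ?_⟩
  obtain ⟨h1, h2⟩ := N.mem_puncturedBall.1 hx
  have hd : ∀ r ∈ Ioo 0 R, HasDerivAt
      (fun s : ℝ => ((Real.log (R / s) ^ (-c) : ℝ) : ℂ) * f (G.dil s (N.angular x))) 0 r := by
    intro r hr
    have hmem := N.dil_angular_mem h1 hr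
    have hL := log_div_pos hr.1 hr.2
    have e1 := (hasDerivAt_log_div_rpow hr.1 hr.2 (-c)).ofReal_comp
    have e2 := N.hasDerivAt_radial_dil h1 hr (hf _ hmem)
    rw [(N.remainder_eq_zero_iff hp hmem).1 (h _ hmem), N.nrm_dil_angular h1 hr.1, ← hc] at e2
    convert! e1.mul e2 using 1
    rw [Real.rpow_sub_one hL.ne']
    push_cast
    have hn : (r : ℂ) ≠ 0 := by exact_mod_cast hr.1.ne'
    have hl : ((Real.log (R / r) : ℝ) : ℂ) ≠ 0 := by exact_mod_cast hL.ne'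
    field_simp
    ring
  have hconst := IsOpen.is_const_of_deriv_eq_zero isOpen_Ioo isPreconnected_Ioo
    (fun r hr => (hd r hr).differentiableAt.differentiableWithinAt)
    (fun r hr => (hd r hr).deriv) (show N.nrm x ∈ Ioo 0 R from ⟨h1, h2⟩)
    (show R / 2 ∈ Ioo 0 R from ⟨by linarith, by linarith⟩)
  rw [N.extremal_eq _ h1]
  simp only
  rw [← hconst, N.dil_angular, ← mul_assoc, ← Complex.ofReal_mul,
    ← Real.rpow_add (log_div_pos h1 h2), add_neg_cancel, Real.rpow_zero, Complex.ofReal_one,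
    one_mul]

theorem remainder_eq_zero_of_extremal (hp : 1 < p) {φ : N.sphere → ℂ}
    (h : ∀ x ∈ N.puncturedBall R, f x = N.extremal p β R φ x) {x : V}
    (hx : x ∈ N.puncturedBall R) : N.remainder p α β R f x = 0 := by
  obtain ⟨h1, h2⟩ := N.mem_puncturedBall.1 hx
  have hL := log_div_pos h1 h2
  rw [N.remainder_eq_zero_iff hp hx, radialDeriv]
  have hev : (fun r : ℝ => f (G.dil r (N.angular x))) =ᶠ[nhds (N.nrm x)] fun r =>
      ((Real.log (R / r) ^ ((β + p) / p) : ℝ) : ℂ) * φ ⟨N.angular x, N.nrm_angular h1⟩ := by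
    filter_upwards [Ioo_mem_nhds h1 h2] with r hr
    have hpos : 0 < N.nrm (G.dil r (N.angular x)) := by
      rw [N.nrm_dil_angular h1 hr.1]; exact hr.1
    rw [h _ (N.dil_angular_mem h1 hr), N.extremal_eq φ hpos, N.nrm_dil_angular h1 hr.1]
    congr 2
    exact Subtype.ext (N.angular_dil_angular h1 r)
  rw [hev.deriv_eq,
    (((hasDerivAt_log_div_rpow h1 h2 ((β + p) / p)).ofReal_comp).mul_const _).deriv, h x hx,
    N.extremal_eq φ h1, Real.rpow_sub_one hL.ne']
  push_cast
  have hn : (N.nrm x : ℂ) ≠ 0 := by exact_mod_cast h1.ne'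
  have hl : ((Real.log (R / N.nrm x) : ℝ) : ℂ) ≠ 0 := by exact_mod_cast hL.ne'
  field_simp

theorem forall_remainder_eq_zero_iff (hp : 1 < p)
    (hf : ∀ x ∈ N.puncturedBall R, N.RadialDifferentiableAt f x) :
    (∀ x ∈ N.puncturedBall R, N.remainder p α β R f x = 0) ↔
      ∃ φ : N.sphere → ℂ, ∀ x ∈ N.puncturedBall R, f x = N.extremal p β R φ x :=
  ⟨N.exists_extremal_of_remainder_eq_zero hp hf,
    fun ⟨_, h⟩ _ hx => N.remainder_eq_zero_of_extremal hp h hx⟩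

theorem radialDifferentiableAt (hf : Differentiable ℝ f) {x : V} (hx : 0 < N.nrm x) :
    N.RadialDifferentiableAt f x := (N.hasDerivAt_radial hf hx).differentiableAt

variable [MeasurableSpace V] [BorelSpace V] (μ : Measure V) [μ.IsHaarMeasure]

/-- The extension by zero of the remainder is continuous and nonnegative, and Haar measure charges
open sets, so a zero integral means vanishing everywhere and not just almost everywhere. -/
theorem integral_remainder_eq_zero_iff (hp : 1 < p) (hf : f ∈ N.testFunctions R) :
    (∫ x in N.ball 1 R, N.remainder p α β R f x ∂μ) = 0 ↔
      ∃ φ : N.sphere → ℂ, ∀ x ∈ N.puncturedBall R, f x = N.extremal p β R φ x := by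
  have hrd : ∀ x ∈ N.puncturedBall R, N.RadialDifferentiableAt f x := fun x hx =>
    N.radialDifferentiableAt (N.differentiable_of_mem hf) (N.mem_puncturedBall.1 hx).1
  rw [← N.forall_remainder_eq_zero_iff (α := α) hp hrd, N.integral_remainder μ hp hf]
  have heq : ∀ x ∈ N.puncturedBall R, N.remainder p α β R f x = N.remainderExt p α β R f x :=
    fun x hx => N.remainder_eq hp hf hx.1
  have hnonneg : 0 ≤ N.remainderExt p α β R f := fun x => by
    by_cases hx : x ∈ N.puncturedBall R
    · rw [← heq x hx]; exact hardyCp_nonneg hp _ _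
    · exact (N.remainderExt_eq_zero hp hf fun h => hx (hf.2.2 h)).ge
  rw [integral_eq_zero_iff_of_nonneg hnonneg (N.integrable_remainderExt μ hp hf)]
  rw [(N.continuous_remainderExt hp hf).ae_eq_iff_eq μ continuous_zero]
  constructor
  · intro h x hx
    rw [heq x hx, h]; rfl
  · intro h
    ext x
    by_cases hx : x ∈ N.puncturedBall R
    · rw [← heq x hx, h x hx]; rfl
    · exact N.remainderExt_eq_zero hp hf fun h => hx (hf.2.2 h)

/-- No nonzero test function is extremal: an extremal function does not vanish near the origin. -/
theorem eq_zero_of_extremal (hf : f ∈ N.testFunctions R) {φ : N.sphere → ℂ}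
    (h : ∀ x ∈ N.puncturedBall R, f x = N.extremal p β R φ x) : f = 0 := by
  ext x
  by_cases hx : x ∈ N.puncturedBall R
  · obtain ⟨h1, h2⟩ := N.mem_puncturedBall.1 hx
    have hcont : Filter.Tendsto (fun t => f (G.flow t x)) Filter.atBot (nhds (f 0)) :=
      (hf.1.continuous.tendsto 0).comp (G.tendsto_flow_atBot x)
    have hev : ∀ᶠ t in Filter.atBot, G.flow t x ∉ tsupport f :=
      (G.tendsto_flow_atBot x).eventually
        ((isClosed_tsupport f).isOpen_compl.mem_nhds (N.zero_notMem_tsupport hf))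
    -- The orbit is followed inwards until it leaves the support; there `L^c` is positive, so the
    -- angular factor, constant along the orbit, must be zero.
    obtain ⟨t, ht, ht0⟩ := (hev.and (Filter.eventually_le_atBot 0)).exists
    have hn : N.nrm (G.flow t x) = Real.exp t * N.nrm x := N.nrm_flow t x
    have hpos : 0 < N.nrm (G.flow t x) := by rw [hn]; exact mul_pos (Real.exp_pos t) h1
    have hlt : N.nrm (G.flow t x) < R := by
      rw [hn]
      exact (mul_le_of_le_one_left h1.le (Real.exp_le_one_iff.2 ht0)).trans_lt h2
    have h3 := h _ (N.mem_puncturedBall.2 ⟨hpos, hlt⟩)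
    rw [image_eq_zero_of_notMem_tsupport ht, N.extremal_eq φ hpos] at h3
    have h4 : φ ⟨N.angular x, N.nrm_angular h1⟩ = 0 := by
      have := (mul_eq_zero.1 h3.symm).resolve_left
        (by exact_mod_cast (Real.rpow_pos_of_pos (log_div_pos hpos hlt) _).ne')
      simpa only [N.angular_flow t h1] using this
    rw [h x hx, N.extremal_eq φ h1, h4, mul_zero]; rfl
  · exact image_eq_zero_of_notMem_tsupport fun h => hx (hf.2.2 h)

/-- For `Q = α + p` the middle term disappears, so equality makes the remainder zero and `f`
extremal. -/
theorem eq_zero_of_equality (hp : 1 < p) (hQ : G.homDim = α + p)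
    (hf : f ∈ N.testFunctions R)
    (h : |(β + p) / p| ^ p * ∫ x in N.ball 1 R, ‖N.hardyTerm p α β R f x‖ ^ p ∂μ =
      ∫ x in N.ball 1 R, ‖N.radialTerm p α β R f x‖ ^ p ∂μ) : f = 0 := by
  have hid := N.hardy_identity (α := α) (β := β) μ hp hf
  rw [h, hQ] at hid
  have h0 : (∫ x in N.ball 1 R, N.remainder p α β R f x ∂μ) = 0 := by
    rw [show α + p - α - p = 0 by ring] at hid
    linarith
  obtain ⟨φ, hφ⟩ := (N.integral_remainder_eq_zero_iff μ hp hf).1 h0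
  exact N.eq_zero_of_extremal hf hφ

theorem norm_hardyTerm_extremal (hp : 1 < p) (hQ : G.homDim = α + p) (φ : N.sphere → ℂ) {x : V}
    (hx : x ∈ N.puncturedBall R) :
    ‖N.hardyTerm p α β R (N.extremal p β R φ) x‖ ^ p =
      ‖N.angularFun φ x‖ ^ p / (N.nrm x ^ G.homDim * Real.log (R / N.nrm x)) := by
  obtain ⟨h1, h2⟩ := N.mem_puncturedBall.1 hx
  have hL := log_div_pos h1 h2
  have hp0 : p ≠ 0 := by linarith
  rw [N.norm_hardyTerm_rpow hp hx, extremal, norm_mul, Complex.norm_real,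
    Real.norm_of_nonneg (Real.rpow_pos_of_pos hL _).le,
    Real.mul_rpow (Real.rpow_pos_of_pos hL _).le (norm_nonneg _), ← Real.rpow_mul hL.le,
    div_mul_cancel₀ _ hp0, weight, hQ, Real.rpow_add_one hL.ne']
  have := (Real.rpow_pos_of_pos hL (β + p)).ne'
  have := (Real.rpow_pos_of_pos h1 (α + p)).ne'
  field_simp

theorem measurable_angular : Measurable N.angular := by
  have : N.angular = fun x => G.flow (-Real.log (N.nrm x)) x := funext N.angular_eq_flow
  rw [this]
  exact G.continuous_flow.measurable.comp
    ((Real.measurable_log.comp N.continuous_nrm.measurable).neg.prodMk measurable_id)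

theorem measurableSet_sphere : MeasurableSet N.sphere :=
  (isClosed_eq N.continuous_nrm continuous_const).measurableSet

theorem measurable_angularFun {φ : N.sphere → ℂ} (hφ : Measurable φ) :
    Measurable (N.angularFun φ) := by
  classical
  have hS : MeasurableSet {x | N.angular x ∈ N.sphere} :=
    N.measurable_angular N.measurableSet_sphere
  refine Measurable.dite (f := fun x : {x // N.angular x ∈ N.sphere} => φ ⟨N.angular x, x.2⟩)
    (g := fun _ => (0 : ℂ)) ?_ measurable_const hS
  exact hφ.comp ((N.measurable_angular.comp measurable_subtype_coe).subtype_mk)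

/-- The function `1 / (a - s)` already fails to be integrable on `(a - 1, a)`. With `s = log |x|`
and `a = log R` this is a divergence at the boundary `|x| = R`. -/
theorem lintegral_inv_log_eq_top (a : ℝ) :
    ∫⁻ s in Iio a, ENNReal.ofReal (a - s)⁻¹ = ⊤ := by
  by_contra hne
  have hint : IntegrableOn (fun s => (s - a)⁻¹) (Iio a) := by
    refine ⟨((measurable_id.sub_const a).inv).aestronglyMeasurable, ?_⟩
    rw [HasFiniteIntegral]
    refine lt_of_le_of_lt (lintegral_mono_ae ?_) (lt_top_iff_ne_top.2 hne)
    filter_upwards [ae_restrict_mem measurableSet_Iio] with s hs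
    rw [← ofReal_norm, Real.norm_eq_abs, abs_inv, abs_of_neg (sub_neg.2 hs), neg_sub]
  have h2 : IntervalIntegrable (fun s => (s - a)⁻¹) volume (a - 1) a := by
    rw [intervalIntegrable_iff_integrableOn_Ioo_of_le (by linarith)]
    exact hint.mono_set fun s hs => hs.2
  rw [intervalIntegrable_sub_inv_iff] at h2
  rcases h2 with h2 | h2
  · linarith
  · exact h2 right_mem_uIcc

/-- In polar coordinates `|x|^(-Q)` cancels the density `e^(sQ)`, leaving the divergent radial
integral times the angular mass `m` of `|φ|^p`. -/
theorem lintegral_extremal_eq_top (hp : 1 < p) (hR : 0 < R) (hQ : G.homDim = α + p)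
    {φ : N.sphere → ℂ} (hφ : Measurable φ)
    (hne : ¬ (N.extremal p β R φ =ᵐ[μ.restrict (N.ball 1 R)] 0)) :
    ∫⁻ x in N.ball 1 R,
      ENNReal.ofReal (‖N.hardyTerm p α β R (N.extremal p β R φ) x‖ ^ p) ∂μ = ⊤ := by
  set D : Set V := {x | 0 < N.nrm x} with hD
  have hDm : MeasurableSet D := (isOpen_lt continuous_const N.continuous_nrm).measurableSet
  have hDinv : ∀ t x, x ∈ D → G.flow t x ∈ D := fun t x hx => by
    simp only [hD, mem_ofPred_eq, nrm_flow] at hx ⊢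
    exact mul_pos (Real.exp_pos t) hx
  set σ : V → ℝ := fun x => Real.log (N.nrm x) with hσ
  have hσm : Measurable σ := Real.measurable_log.comp N.continuous_nrm.measurable
  have hσt : ∀ t, ∀ x ∈ D, σ (G.flow t x) = σ x + t := fun t x hx => by
    simp only [hσ, nrm_flow]
    rw [Real.log_mul (Real.exp_pos t).ne' (ne_of_gt hx), Real.log_exp, add_comm]
  set h : V → ENNReal := fun x => ENNReal.ofReal (‖N.angularFun φ x‖ ^ p) with hh
  have hhm : Measurable h :=
    ((N.measurable_angularFun hφ).norm.pow_const p).ennreal_ofReal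
  have hhinv : ∀ t, ∀ x ∈ D, h (G.flow t x) = h x := fun t x hx => by
    have hx' : 0 < N.nrm (G.flow t x) := hDinv t x hx
    simp only [hh]
    rw [N.angularFun_of_pos φ hx', N.angularFun_of_pos φ (show 0 < N.nrm x from hx)]
    simp only [N.angular_flow t hx]
  have hpol := fun {H : ℝ → ENNReal} (hH : Measurable H) =>
    G.lintegral_polar μ hDm hDinv hσm hσt hH hhm hhinv
  set m := ∫⁻ x in D ∩ σ ⁻¹' Ico 0 1, ENNReal.ofReal (Real.exp (-(σ x * G.homDim))) * h x ∂μ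
  -- If the angular mass were zero, the polar formula with `H = 1` would make `φ(x / |x|)`, hence
  -- the extremal function, vanish almost everywhere.
  have hm : m ≠ 0 := by
    intro hm0
    have h1 := hpol (H := fun _ => 1) measurable_const
    simp only [one_mul] at h1
    rw [hm0, zero_mul, lintegral_eq_zero_iff hhm,
      Filter.EventuallyEq, ae_restrict_iff' hDm] at h1
    refine hne (ae_restrict_of_ae ?_)
    filter_upwards [h1] with x hx
    by_cases hxD : x ∈ D
    · have h2 := hx hxD
      simp only [hh, Pi.zero_apply, ENNReal.ofReal_eq_zero] at h2
      have h3 := (Real.rpow_eq_zero (norm_nonneg _) (by linarith)).1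
        (le_antisymm h2 (Real.rpow_nonneg (norm_nonneg _) p))
      rw [extremal, norm_eq_zero.1 h3, mul_zero]; rfl
    -- At the origin `angular` is 0, which is off the sphere, so the function is 0 by convention.
    · have hx0 : x = 0 := by
        by_contra h0
        exact hxD (N.nrm_pos_iff.2 h0)
      have hz : N.angularFun φ x = 0 := by
        rw [angularFun, dif_neg]
        rw [hx0, angular_eq_flow, map_zero, sphere, mem_ofPred_eq, N.nrm_zero]
        exact zero_ne_one
      rw [extremal, hz, mul_zero]; rfl
  set H : ℝ → ENNReal := (Iio (Real.log R)).indicator fun s =>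
    ENNReal.ofReal (Real.log R - s)⁻¹ * ENNReal.ofReal (Real.exp (-(s * G.homDim))) with hHdef
  have hHm : Measurable H :=
    (((measurable_const.sub measurable_id).inv.ennreal_ofReal).mul
      ((Real.measurable_exp.comp (measurable_id.mul_const _).neg).ennreal_ofReal)).indicator
      measurableSet_Iio
  have h1 := hpol hHm
  have h2 : ∫⁻ s, H s * ENNReal.ofReal (Real.exp (s * G.homDim)) = ⊤ := by
    rw [← lintegral_inv_log_eq_top (Real.log R), ← lintegral_indicator measurableSet_Iio]
    refine lintegral_congr fun s => ?_
    by_cases hs : s ∈ Iio (Real.log R)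
    · rw [hHdef, indicator_of_mem hs, indicator_of_mem hs, mul_assoc,
        ← ENNReal.ofReal_mul (Real.exp_pos _).le, ← Real.exp_add]
      simp
    · rw [hHdef, indicator_of_notMem hs, indicator_of_notMem hs, zero_mul]
  rw [h2, ENNReal.mul_top hm] at h1
  rw [eq_top_iff, ← h1]
  have hsub : N.puncturedBall R ⊆ N.ball 1 R := fun x hx => hx.1
  refine le_trans ?_ (lintegral_mono_set hsub)
  rw [← lintegral_indicator hDm, ← lintegral_indicator (N.isOpen_puncturedBall R).measurableSet]
  refine lintegral_mono fun x => ?_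
  by_cases hxD : x ∈ D
  · rw [indicator_of_mem hxD]
    have hx0 : 0 < N.nrm x := hxD
    by_cases hlt : N.nrm x < R
    · have hx : x ∈ N.puncturedBall R := N.mem_puncturedBall.2 ⟨hx0, hlt⟩
      have hs : σ x ∈ Iio (Real.log R) := Real.log_lt_log hx0 hlt
      rw [indicator_of_mem hx, N.norm_hardyTerm_extremal hp hQ φ hx, hHdef, indicator_of_mem hs,
        hh, ← ENNReal.ofReal_mul (inv_nonneg.2 (sub_nonneg.2 (le_of_lt hs))),
        ← ENNReal.ofReal_mul (mul_nonneg (inv_nonneg.2 (sub_nonneg.2 (le_of_lt hs)))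
          (Real.exp_pos _).le)]
      refine le_of_eq (congrArg _ ?_)
      rw [Real.log_div hR.ne' hx0.ne', Real.rpow_def_of_pos hx0, Real.exp_neg, div_eq_mul_inv,
        mul_inv]
      ring
    · have hs : σ x ∉ Iio (Real.log R) := by
        rw [mem_Iio, not_lt]
        exact Real.log_le_log hR (not_lt.1 hlt)
      rw [hHdef, indicator_of_notMem hs, zero_mul]
      exact zero_le
  · rw [indicator_of_notMem hxD]
    exact zero_le

/-- If `φ y ≠ 0`, the function is nonzero at the dilate of `y` to radius `R / 2`, and so on an open
neighbourhood, which has positive measure. -/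
theorem not_ae_eq_zero_of_continuous (hR : 0 < R) {φ : N.sphere → ℂ} (hφ : Continuous φ)
    (hne : φ ≠ 0) : ¬ (N.extremal p β R φ =ᵐ[μ.restrict (N.ball 1 R)] 0) := by
  intro hae
  obtain ⟨y, hy⟩ := Function.ne_iff.1 hne
  have hy1 : N.nrm y = 1 := y.2
  set z : V := G.dil (R / 2) y with hz
  have hzn : N.nrm z = R / 2 := by rw [hz, N.nrm_dil _ (by linarith), hy1, mul_one]
  have hz0 : 0 < N.nrm z := by rw [hzn]; linarith
  have hzU : z ∈ N.puncturedBall R := N.mem_puncturedBall.2 ⟨hz0, by rw [hzn]; linarith⟩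
  have hya : N.angular y = y := by rw [angular_eq_flow, hy1, Real.log_one, neg_zero, flow_zero]
  have hza : N.angular z = y := by
    rw [hz, dil_eq_flow, N.angular_flow _ (by rw [hy1]; exact one_pos), hya]
  have hcont : ContinuousOn (N.angularFun φ) (N.puncturedBall R) := by
    rw [continuousOn_iff_continuous_domRestrict]
    have : (N.puncturedBall R).domRestrict (N.angularFun φ) = fun x : N.puncturedBall R =>
        φ ⟨N.angular x, N.nrm_angular (N.mem_puncturedBall.1 x.2).1⟩ :=
      funext fun x => N.angularFun_of_pos φ (N.mem_puncturedBall.1 x.2).1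
    rw [this]
    refine hφ.comp (Continuous.subtype_mk ?_ _)
    simp_rw [angular_eq_flow]
    refine G.continuous_flow.comp (Continuous.prodMk (Continuous.neg
      (Continuous.log (N.continuous_nrm.comp continuous_subtype_val) fun x => ?_))
      continuous_subtype_val)
    exact (N.mem_puncturedBall.1 x.2).1.ne'
  have hzval : N.angularFun φ z ≠ 0 := by
    rw [N.angularFun_of_pos φ hz0]
    have : (⟨N.angular z, N.nrm_angular hz0⟩ : N.sphere) = y := Subtype.ext hza
    rw [this]
    exact hy
  have hopen : IsOpen (N.puncturedBall R ∩ N.angularFun φ ⁻¹' {0}ᶜ) :=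
    hcont.isOpen_inter_preimage (N.isOpen_puncturedBall R) isOpen_compl_singleton
  have hpos := hopen.measure_pos μ ⟨z, hzU, hzval⟩
  rw [Filter.EventuallyEq, ae_restrict_iff' (N.isOpen_ball_one R).measurableSet, ae_iff] at hae
  refine hpos.ne' (measure_mono_null ?_ hae)
  rintro x ⟨hx, hx0⟩ himp
  have h0 := himp hx.1
  obtain ⟨h1, h2⟩ := N.mem_puncturedBall.1 hx
  rw [extremal] at h0
  rcases mul_eq_zero.1 h0 with h | h
  · exact (Real.rpow_pos_of_pos (log_div_pos h1 h2) _).ne' (by exact_mod_cast h)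
  · exact hx0 h

end Extremal

end HomogeneousLieGroup.QuasiNorm

/-! ### Sharpness of the one-dimensional inequality. -/

section OneDim

/-- The function `(a - s) ^ c χ (log (a - s) / k)`, extended by zero past `a`. -/
def logProfile (a c k : ℝ) (χ : ℝ → ℝ) (s : ℝ) : ℝ :=
  if s < a then (a - s) ^ c * χ (Real.log (a - s) / k) else 0

variable {a c k : ℝ} {χ : ℝ → ℝ}

theorem logProfile_eq_zero (hk : 0 < k) (hχ : ∀ τ ∉ Icc (-2) (-1), χ τ = 0) {s : ℝ}
    (hs : s ∉ Icc (a - Real.exp (-k)) (a - Real.exp (-(2 * k)))) : logProfile a c k χ s = 0 := by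
  rw [logProfile]
  split_ifs with h
  · rw [hχ, mul_zero]
    rintro ⟨h1, h2⟩
    have hpos : 0 < a - s := sub_pos.2 h
    rw [le_div_iff₀ hk, Real.le_log_iff_exp_le hpos] at h1
    rw [div_le_iff₀ hk, Real.log_le_iff_le_exp hpos] at h2
    refine hs ⟨?_, ?_⟩
    · rw [neg_one_mul] at h2; linarith
    · rw [neg_mul] at h1; linarith
  · rfl

theorem hasDerivAt_logProfile (hk : 0 < k) (hχ : ContDiff ℝ ∞ χ) {s : ℝ} (hs : s < a) :
    HasDerivAt (logProfile a c k χ)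
      (-((a - s) ^ (c - 1) * (c * χ (Real.log (a - s) / k) +
        deriv χ (Real.log (a - s) / k) / k))) s := by
  have hpos : 0 < a - s := sub_pos.2 hs
  have h1 : HasDerivAt (fun s => a - s) (-1) s := by simpa using (hasDerivAt_id s).const_sub a
  have h2 := h1.rpow_const (p := c) (Or.inl hpos.ne')
  have h3 := (h1.log hpos.ne').div_const k
  have h4 := ((hχ.differentiable (by simp) _).hasDerivAt).comp s h3
  have h5 := h2.mul h4
  have hev : logProfile a c k χ =ᶠ[nhds s]
      ((fun s => (a - s) ^ c) * (χ ∘ fun s => Real.log (a - s) / k)) := by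
    filter_upwards [gt_mem_nhds hs] with q hq
    rw [logProfile, if_pos hq]; rfl
  refine (h5.congr_of_eventuallyEq hev).congr_deriv ?_
  rw [Real.rpow_sub_one hpos.ne']
  field_simp
  simp only [Function.comp_apply]
  ring

/-- The singular point `s = a` is harmless: the cut-off vanishes beyond `a - e^(-2k)`. -/
theorem contDiff_logProfile (hk : 0 < k) (hχ : ContDiff ℝ ∞ χ)
    (hχ0 : ∀ τ ∉ Icc (-2) (-1), χ τ = 0) : ContDiff ℝ ∞ (logProfile a c k χ) := by
  rw [contDiff_iff_contDiffAt]
  intro s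
  rcases lt_or_ge s a with hs | hs
  · have hpos : a - s ≠ 0 := (sub_pos.2 hs).ne'
    have hsub : ContDiffAt ℝ ∞ (fun s => a - s) s := contDiffAt_const.sub contDiffAt_id
    have : ContDiffAt ℝ ∞ (fun s => (a - s) ^ c * χ (Real.log (a - s) / k)) s :=
      (hsub.rpow_const_of_ne hpos).mul
        (hχ.contDiffAt.comp s ((hsub.log hpos).div_const k))
    refine this.congr_of_eventuallyEq ?_
    filter_upwards [gt_mem_nhds hs] with q hq
    rw [logProfile, if_pos hq]
  · have : logProfile a c k χ =ᶠ[nhds s] fun _ => 0 := by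
      have hlt : a - Real.exp (-(2 * k)) < s := by have := Real.exp_pos (-(2 * k)); linarith
      filter_upwards [lt_mem_nhds hlt] with q hq
      exact logProfile_eq_zero hk hχ0 fun h => absurd h.2 (not_le.2 hq)
    exact contDiffAt_const.congr_of_eventuallyEq this

/-- Substitution `a - s = e^(kτ)`, for which `ds / (a - s)` becomes `k dτ` up to orientation. -/
theorem integral_log_subst (hk : 0 < k) (γ : ℝ) (Γ : ℝ → ℝ) :
    ∫ s in Iio a, (a - s)⁻¹ * Γ (Real.log (a - s) / k) * Real.exp (γ * s) =
      k * Real.exp (γ * a) * ∫ τ, Γ τ * Real.exp (-(γ * Real.exp (k * τ))) := by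
  have himg : (fun τ => a - Real.exp (k * τ)) '' univ = Iio a := by
    ext s
    simp only [image_univ, mem_range, mem_Iio]
    constructor
    · rintro ⟨τ, rfl⟩
      have := Real.exp_pos (k * τ); linarith
    · intro hs
      refine ⟨Real.log (a - s) / k, ?_⟩
      rw [mul_div_cancel₀ _ hk.ne', Real.exp_log (sub_pos.2 hs)]
      ring
  have hder : ∀ τ ∈ univ, HasDerivWithinAt (fun τ => a - Real.exp (k * τ))
      (-(Real.exp (k * τ) * k)) univ τ := fun τ _ => by
    have := (((hasDerivAt_id τ).const_mul k).exp).const_sub a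
    simpa using this.hasDerivWithinAt (s := univ)
  have hinj : InjOn (fun τ => a - Real.exp (k * τ)) univ := fun x _ y _ h => by
    have h1 : Real.exp (k * x) = Real.exp (k * y) := by simpa using h
    exact mul_left_cancel₀ hk.ne' (Real.exp_injective h1)
  rw [← himg, integral_image_eq_integral_abs_deriv_smul MeasurableSet.univ hder hinj,
    setIntegral_univ, ← integral_const_mul]
  refine integral_congr_ae (Filter.Eventually.of_forall fun τ => ?_)
  simp only [sub_sub_cancel, Real.log_exp, smul_eq_mul]
  rw [abs_neg, abs_of_pos (mul_pos (Real.exp_pos _) hk), mul_div_cancel_left₀ _ hk.ne',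
    show γ * (a - Real.exp (k * τ)) = γ * a + -(γ * Real.exp (k * τ)) by ring, Real.exp_add]
  have := (Real.exp_pos (k * τ)).ne'
  field_simp

/-- The exponent satisfies `c p = β + p`, so all powers of `a - s` collapse to `(a - s)⁻¹` and the
substitution applies; the same happens for the derivative, whose power is `(c - 1) p = β`. -/
theorem integral_logProfile {p β γ : ℝ} (hp : 1 < p) (hk : 0 < k) :
    ∫ s, |logProfile a ((β + p) / p) k χ s| ^ p * ((a - s) ^ (β + p + 1))⁻¹ * Real.exp (γ * s) =
      k * Real.exp (γ * a) * ∫ τ, |χ τ| ^ p * Real.exp (-(γ * Real.exp (k * τ))) := by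
  have hp0 : p ≠ 0 := by linarith
  rw [← integral_log_subst hk γ fun τ => |χ τ| ^ p,
    ← setIntegral_eq_integral_of_forall_compl_eq_zero (s := Iio a)]
  · refine setIntegral_congr_fun measurableSet_Iio fun s hs => ?_
    have hpos : 0 < a - s := sub_pos.2 hs
    rw [logProfile, if_pos (show s < a from hs), abs_mul,
      abs_of_pos (Real.rpow_pos_of_pos hpos _),
      Real.mul_rpow (Real.rpow_pos_of_pos hpos _).le (abs_nonneg _), ← Real.rpow_mul hpos.le,
      div_mul_cancel₀ _ hp0, Real.rpow_add_one hpos.ne']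
    have := (Real.rpow_pos_of_pos hpos (β + p)).ne'
    field_simp
  · intro s hs
    rw [logProfile, if_neg (show ¬ s < a from hs), abs_zero, Real.zero_rpow hp0, zero_mul, zero_mul]

theorem integral_deriv_logProfile {p β γ : ℝ} (hp : 1 < p) (hk : 0 < k) (hχ : ContDiff ℝ ∞ χ)
    (hχ0 : ∀ τ ∉ Icc (-2) (-1), χ τ = 0) :
    ∫ s, |deriv (logProfile a ((β + p) / p) k χ) s| ^ p * ((a - s) ^ (β + 1))⁻¹ *
        Real.exp (γ * s) =
      k * Real.exp (γ * a) * ∫ τ, |(β + p) / p * χ τ + deriv χ τ / k| ^ p *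
        Real.exp (-(γ * Real.exp (k * τ))) := by
  have hp0 : p ≠ 0 := by linarith
  rw [← integral_log_subst hk γ fun τ => |(β + p) / p * χ τ + deriv χ τ / k| ^ p,
    ← setIntegral_eq_integral_of_forall_compl_eq_zero (s := Iio a)]
  · refine setIntegral_congr_fun measurableSet_Iio fun s hs => ?_
    have hpos : 0 < a - s := sub_pos.2 hs
    rw [(hasDerivAt_logProfile hk hχ (show s < a from hs)).deriv, abs_neg, abs_mul,
      abs_of_pos (Real.rpow_pos_of_pos hpos _),
      Real.mul_rpow (Real.rpow_pos_of_pos hpos _).le (abs_nonneg _), ← Real.rpow_mul hpos.le,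
      sub_mul, div_mul_cancel₀ _ hp0, one_mul, add_sub_cancel_right, Real.rpow_add_one hpos.ne']
    have := (Real.rpow_pos_of_pos hpos β).ne'
    field_simp
  · intro s hs
    have hz : deriv (logProfile a ((β + p) / p) k χ) s = 0 := by
      have hev : logProfile a ((β + p) / p) k χ =ᶠ[nhds s] fun _ => 0 := by
        have hlt : a - Real.exp (-(2 * k)) < s := by
          have := Real.exp_pos (-(2 * k))
          have : a ≤ s := not_lt.1 hs
          linarith
        filter_upwards [lt_mem_nhds hlt] with q hq
        exact logProfile_eq_zero hk hχ0 fun h => absurd h.2 (not_le.2 hq)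
      rw [hev.deriv_eq, deriv_const]
    rw [hz, abs_zero, Real.zero_rpow hp0, zero_mul, zero_mul]

/-- Sharpness of the one-dimensional inequality, tested on `logProfile` as `k → ∞`. -/
theorem le_of_forall_oneDim {p β γ C : ℝ} (hp : 1 < p)
    (h : ∀ g : ℝ → ℝ, ContDiff ℝ ∞ g → (∃ s₀ s₁, s₁ < a ∧ ∀ s ∉ Icc s₀ s₁, g s = 0) →
      C * ∫ s, |g s| ^ p * ((a - s) ^ (β + p + 1))⁻¹ * Real.exp (γ * s) ≤
        ∫ s, |deriv g s| ^ p * ((a - s) ^ (β + 1))⁻¹ * Real.exp (γ * s)) :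
    C ≤ |(β + p) / p| ^ p := by
  have hp0 : 0 < p := by linarith
  set c := (β + p) / p with hc
  -- Centre `-3/2` and outer radius `1/2` place the support in `[-2, -1]`. There `e^(kτ) → 0` as `k
  -- → ∞`, so the profile concentrates at `s = a`, where the weight `e^(γ s)` is asymptotically
  -- constant.
  let χ : ContDiffBump (-(3 / 2) : ℝ) := ⟨1 / 4, 1 / 2, by norm_num, by norm_num⟩
  have hχ : ContDiff ℝ ∞ χ := χ.contDiff
  have hχ0 : ∀ τ ∉ Icc (-2 : ℝ) (-1), χ τ = 0 := by
    intro τ hτ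
    refine χ.zero_of_le_dist (not_lt.1 fun hlt => hτ ?_)
    have hlt' : |τ - -(3 / 2)| < 1 / 2 := hlt
    rw [abs_lt] at hlt'
    constructor <;> linarith [hlt'.1, hlt'.2]
  have hd0 : ∀ τ ∉ Icc (-2 : ℝ) (-1), deriv χ τ = 0 := by
    intro τ hτ
    have hev : (χ : ℝ → ℝ) =ᶠ[nhds τ] fun _ => 0 := by
      filter_upwards [isClosed_Icc.isOpen_compl.mem_nhds hτ] with q hq
      exact hχ0 q hq
    rw [hev.deriv_eq, deriv_const]
  have hdc : Continuous (deriv χ) := hχ.continuous_deriv (by simp)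
  obtain ⟨M, hM⟩ := isCompact_Icc.exists_bound_of_continuousOn (s := Icc (-2 : ℝ) (-1))
    hdc.continuousOn
  have hM0 : 0 ≤ M := (norm_nonneg _).trans (hM (-1) ⟨by norm_num, le_rfl⟩)
  -- Both sides carry the same positive factor `k e^(γ a)`, which is cancelled. In the limit the
  -- exponential tends to 1 and `χ' / k` to 0, leaving `C ∫ |χ|^p ≤ |c|^p ∫ |χ|^p`.
  have key : ∀ n : ℕ, C * ∫ τ, |χ τ| ^ p * Real.exp (-(γ * Real.exp (((n : ℝ) + 1) * τ))) ≤
      ∫ τ, |c * χ τ + deriv χ τ / ((n : ℝ) + 1)| ^ p *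
        Real.exp (-(γ * Real.exp (((n : ℝ) + 1) * τ))) := by
    intro n
    have hk : (0 : ℝ) < n + 1 := by positivity
    have := h (logProfile a c (n + 1) χ) (contDiff_logProfile hk hχ hχ0)
      ⟨_, _, by linarith [Real.exp_pos (-(2 * ((n : ℝ) + 1)))],
        fun s hs => logProfile_eq_zero hk hχ0 hs⟩
    rw [integral_logProfile hp hk, integral_deriv_logProfile hp hk hχ hχ0,
      mul_left_comm] at this
    exact le_of_mul_le_mul_left this (mul_pos hk (Real.exp_pos _))
  have hE : ∀ n : ℕ, ∀ τ ∈ Icc (-2 : ℝ) (-1),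
      Real.exp (-(γ * Real.exp (((n : ℝ) + 1) * τ))) ≤ Real.exp |γ| := by
    intro n τ hτ
    refine Real.exp_le_exp.2 ((neg_le_abs _).trans ?_)
    rw [abs_mul, abs_of_pos (Real.exp_pos _)]
    refine mul_le_of_le_one_right (abs_nonneg _) (Real.exp_le_one_iff.2 ?_)
    have : (0 : ℝ) ≤ n := n.cast_nonneg
    nlinarith [hτ.2]
  have hElim : ∀ τ ∈ Icc (-2 : ℝ) (-1), Filter.Tendsto
      (fun n : ℕ => Real.exp (-(γ * Real.exp (((n : ℝ) + 1) * τ)))) Filter.atTop (nhds 1) := by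
    intro τ hτ
    have h1 : Filter.Tendsto (fun n : ℕ => ((n : ℝ) + 1) * τ) Filter.atTop Filter.atBot :=
      (Filter.tendsto_atTop_add_const_right _ 1 tendsto_natCast_atTop_atTop).atTop_mul_const_of_neg
        (by linarith [hτ.2])
    have h2 := ((Real.tendsto_exp_atBot.comp h1).const_mul γ).neg
    have h3 := (Real.continuous_exp.tendsto _).comp h2
    simpa [Function.comp_def] using h3
  have hlim1 : Filter.Tendsto
      (fun n : ℕ => ∫ τ, |χ τ| ^ p * Real.exp (-(γ * Real.exp (((n : ℝ) + 1) * τ))))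
      Filter.atTop (nhds (∫ τ, |χ τ| ^ p)) := by
    refine tendsto_integral_of_dominated_convergence
      ((Icc (-2 : ℝ) (-1)).indicator fun _ => Real.exp |γ|) (fun n => ?_) ?_ (fun n => ?_) ?_
    · refine Continuous.aestronglyMeasurable (Continuous.mul ?_ (by fun_prop))
      exact χ.continuous.abs.rpow_const fun _ => Or.inr hp0.le
    · exact (integrable_indicator_iff measurableSet_Icc).2
        (integrableOn_const isCompact_Icc.measure_lt_top.ne)
    · refine Filter.Eventually.of_forall fun τ => ?_
      by_cases hτ : τ ∈ Icc (-2 : ℝ) (-1)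
      · rw [indicator_of_mem hτ, Real.norm_of_nonneg (by positivity)]
        refine (mul_le_of_le_one_left (Real.exp_pos _).le ?_).trans (hE n τ hτ)
        exact Real.rpow_le_one (abs_nonneg _) (abs_le.2 ⟨by linarith [χ.nonneg (x := τ)], χ.le_one⟩)
          hp0.le
      · rw [indicator_of_notMem hτ, hχ0 τ hτ]
        simp [Real.zero_rpow hp0.ne']
    · refine Filter.Eventually.of_forall fun τ => ?_
      by_cases hτ : τ ∈ Icc (-2 : ℝ) (-1)
      · simpa using (hElim τ hτ).const_mul (|χ τ| ^ p)
      · simp [hχ0 τ hτ, Real.zero_rpow hp0.ne']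
  have hlim2 : Filter.Tendsto
      (fun n : ℕ => ∫ τ, |c * χ τ + deriv χ τ / ((n : ℝ) + 1)| ^ p *
        Real.exp (-(γ * Real.exp (((n : ℝ) + 1) * τ))))
      Filter.atTop (nhds (∫ τ, |c| ^ p * |χ τ| ^ p)) := by
    refine tendsto_integral_of_dominated_convergence
      ((Icc (-2 : ℝ) (-1)).indicator fun _ => (|c| + M) ^ p * Real.exp |γ|) (fun n => ?_) ?_
      (fun n => ?_) ?_
    · refine Continuous.aestronglyMeasurable (Continuous.mul ?_ (by fun_prop))
      exact ((continuous_const.mul χ.continuous).add (hdc.div_const _)).abs.rpow_const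
        fun _ => Or.inr hp0.le
    · exact (integrable_indicator_iff measurableSet_Icc).2
        (integrableOn_const isCompact_Icc.measure_lt_top.ne)
    · refine Filter.Eventually.of_forall fun τ => ?_
      by_cases hτ : τ ∈ Icc (-2 : ℝ) (-1)
      · rw [indicator_of_mem hτ, Real.norm_of_nonneg (by positivity)]
        refine mul_le_mul (Real.rpow_le_rpow (abs_nonneg _) ?_ hp0.le) (hE n τ hτ)
          (Real.exp_pos _).le (by positivity)
        refine (abs_add_le _ _).trans (add_le_add ?_ ?_)
        · rw [abs_mul]
          exact mul_le_of_le_one_right (abs_nonneg _)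
            (abs_le.2 ⟨by linarith [χ.nonneg (x := τ)], χ.le_one⟩)
        · have hk : (1 : ℝ) ≤ n + 1 := by linarith [n.cast_nonneg (α := ℝ)]
          rw [abs_div, abs_of_pos (by linarith : (0 : ℝ) < n + 1)]
          exact (div_le_self (abs_nonneg _) hk).trans (hM τ hτ)
      · rw [indicator_of_notMem hτ, hχ0 τ hτ, hd0 τ hτ]
        simp [Real.zero_rpow hp0.ne']
    · refine Filter.Eventually.of_forall fun τ => ?_
      by_cases hτ : τ ∈ Icc (-2 : ℝ) (-1)
      · have h1 : Filter.Tendsto (fun n : ℕ => c * χ τ + deriv χ τ / ((n : ℝ) + 1)) Filter.atTop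
            (nhds (c * χ τ + 0)) := by
          refine tendsto_const_nhds.add ?_
          simpa [div_eq_mul_inv] using tendsto_one_div_add_atTop_nhds_zero_nat.const_mul (deriv χ τ)
        have h2 := (h1.abs.rpow_const (p := p) (Or.inr hp0.le)).mul (hElim τ hτ)
        rw [add_zero, mul_one, abs_mul, Real.mul_rpow (abs_nonneg _) (abs_nonneg _)] at h2
        exact h2
      · simp [hχ0 τ hτ, hd0 τ hτ, Real.zero_rpow hp0.ne']
  have hfin := le_of_tendsto_of_tendsto' (hlim1.const_mul C) hlim2 key
  rw [integral_const_mul] at hfin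
  refine le_of_mul_le_mul_right hfin ?_
  have hcont : Continuous fun τ => |χ τ| ^ p := χ.continuous.abs.rpow_const fun _ => Or.inr hp0.le
  refine hcont.integral_pos_of_hasCompactSupport_nonneg_nonzero
    (HasCompactSupport.intro isCompact_Icc fun τ hτ => by
      rw [hχ0 τ hτ, abs_zero, Real.zero_rpow hp0.ne'])
    (fun τ => Real.rpow_nonneg (abs_nonneg _) _) (x := -(3 / 2)) ?_
  rw [χ.one_of_mem_closedBall (Metric.mem_closedBall_self χ.rIn_pos.le)]
  simp

end OneDim

/-! ### Smooth conical coordinates and product test functions. -/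

namespace HomogeneousLieGroup

variable {V : Type*} [NormedAddCommGroup V] [NormedSpace ℝ V] [Group V] [LieGroup 𝓘(ℝ, V) ∞ V]
  {G : HomogeneousLieGroup V} [FiniteDimensional ℝ V]

/-- A coordinate functional of an eigenbasis, normalised at the corresponding basis vector after
dilating that vector to the unit quasi-sphere. Being linear, it is a smooth substitute for the
quasi-norm on a half space. -/
theorem QuasiNorm.exists_homogeneous_functional [Nontrivial V] (N : G.QuasiNorm) :
    ∃ (l : V →L[ℝ] ℝ) (ν : ℝ) (y₀ : V), 0 < ν ∧ (∀ t x, l (G.flow t x) = Real.exp (t * ν) * l x) ∧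
      l y₀ = 1 ∧ N.nrm y₀ = 1 := by
  obtain ⟨b, ν, hb, hν⟩ := G.exists_eigenbasis
  let i : Fin (Module.finrank ℝ V) := ⟨0, Module.finrank_pos⟩
  have hpos : 0 < N.nrm (b i) := N.nrm_pos_iff.2 (b.ne_zero i)
  set y₀ := N.angular (b i) with hy
  have hfl : ∀ t x, b.coord i (G.flow t x) = Real.exp (t * ν i) * b.coord i x := by
    intro t x
    rw [G.flow_eq_sum b hb, map_sum, Finset.sum_eq_single i]
    · simp
    · intro j _ hj
      simp [hj]
    · simp
  have hy₀ : b.coord i y₀ ≠ 0 := by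
    rw [hy, N.angular_eq_flow, hfl]
    simp
  refine ⟨(b.coord i y₀)⁻¹ • (b.coord i).toContinuousLinearMap, ν i, y₀, hν i, fun t x => ?_, ?_,
    N.nrm_angular hpos⟩
  · simp only [smul_apply, LinearMap.coe_toContinuousLinearMap', smul_eq_mul,
      hfl]
    ring
  · simp only [smul_apply, LinearMap.coe_toContinuousLinearMap', smul_eq_mul]
    exact inv_mul_cancel₀ hy₀

/-- The logarithmic radius attached to a homogeneous functional `l` of degree `ν`. -/
def logRadius (l : V →L[ℝ] ℝ) (ν : ℝ) (x : V) : ℝ := Real.log (l x) / ν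

/-- The projection of the half space `0 < l` to the hyperplane `l = 1` along the dilations. -/
def hyperProj (G : HomogeneousLieGroup V) (l : V →L[ℝ] ℝ) (ν : ℝ) (x : V) : V :=
  G.flow (-logRadius l ν x) x

/-- A function in product form in the coordinates `logRadius`, `hyperProj`. -/
def coneFun (G : HomogeneousLieGroup V) (l : V →L[ℝ] ℝ) (ν : ℝ) (g : ℝ → ℝ) (ψ : V → ℝ) (x : V) :
    ℝ :=
  if 0 < l x then g (logRadius l ν x) * ψ (G.hyperProj l ν x) else 0

section Chart

variable {l : V →L[ℝ] ℝ} {ν : ℝ} (hν : 0 < ν)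
  (hl : ∀ t x, l (G.flow t x) = Real.exp (t * ν) * l x)

include hl in
theorem functional_flow_pos {t : ℝ} {x : V} (hx : 0 < l x) : 0 < l (G.flow t x) := by
  rw [hl]; exact mul_pos (Real.exp_pos _) hx

include hν hl in
theorem logRadius_flow (t : ℝ) {x : V} (hx : 0 < l x) :
    logRadius l ν (G.flow t x) = logRadius l ν x + t := by
  rw [logRadius, logRadius, hl, Real.log_mul (Real.exp_pos _).ne' hx.ne', Real.log_exp]
  field_simp
  ring

include hν hl in
theorem hyperProj_flow (t : ℝ) {x : V} (hx : 0 < l x) :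
    G.hyperProj l ν (G.flow t x) = G.hyperProj l ν x := by
  rw [hyperProj, hyperProj, logRadius_flow hν hl t hx, ← flow_add]
  congr 2; ring

theorem flow_hyperProj (x : V) : G.flow (logRadius l ν x) (G.hyperProj l ν x) = x := by
  rw [hyperProj, ← flow_add, add_neg_cancel, flow_zero]

include hν hl in
theorem functional_hyperProj {x : V} (hx : 0 < l x) : l (G.hyperProj l ν x) = 1 := by
  rw [hyperProj, hl, logRadius, neg_mul, div_mul_cancel₀ _ hν.ne', Real.exp_neg, Real.exp_log hx,
    inv_mul_cancel₀ hx.ne']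

theorem hyperProj_of_functional_eq_one {x : V} (hx : l x = 1) : G.hyperProj l ν x = x := by
  rw [hyperProj, logRadius, hx, Real.log_one, zero_div, neg_zero, flow_zero]

include hν hl in
theorem coneFun_flow (g : ℝ → ℝ) (ψ : V → ℝ) (t : ℝ) {x : V} (hx : 0 < l x) :
    G.coneFun l ν g ψ (G.flow t x) =
      g (logRadius l ν x + t) * ψ (G.hyperProj l ν x) := by
  rw [coneFun, if_pos (functional_flow_pos hl hx), logRadius_flow hν hl t hx,
    hyperProj_flow hν hl t hx]

/-- The image of a rectangle in the coordinates `logRadius`, `hyperProj`. -/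
def coneBox (G : HomogeneousLieGroup V) (l : V →L[ℝ] ℝ) (s₀ s₁ : ℝ) (B : Set V) : Set V :=
  (fun q : ℝ × V => G.flow q.1 q.2) '' (Icc s₀ s₁ ×ˢ (B ∩ {y | l y = 1}))

theorem isCompact_coneBox {s₀ s₁ : ℝ} {B : Set V} (hB : IsCompact B) :
    IsCompact (G.coneBox l s₀ s₁ B) :=
  (isCompact_Icc.prod (hB.inter_right (isClosed_eq l.continuous continuous_const))).image
    G.continuous_flow

include hν hl in
theorem mem_coneBox {s₀ s₁ : ℝ} {B : Set V} {x : V} (hx : 0 < l x)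
    (hs : logRadius l ν x ∈ Icc s₀ s₁) (hB : G.hyperProj l ν x ∈ B) : x ∈ G.coneBox l s₀ s₁ B :=
  ⟨(logRadius l ν x, G.hyperProj l ν x), ⟨hs, hB, functional_hyperProj hν hl hx⟩,
    flow_hyperProj x⟩

variable {g : ℝ → ℝ} {ψ : V → ℝ} {s₀ s₁ : ℝ} {B : Set V}

include hν hl in
theorem coneFun_eq_zero (hg0 : ∀ s ∉ Icc s₀ s₁, g s = 0) (hψ0 : ∀ y ∉ B, ψ y = 0) {x : V}
    (hx : x ∉ G.coneBox l s₀ s₁ B) : G.coneFun l ν g ψ x = 0 := by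
  rw [coneFun]
  split_ifs with h
  · by_cases hs : logRadius l ν x ∈ Icc s₀ s₁
    · rw [hψ0 _ fun hB => hx (mem_coneBox hν hl h hs hB), mul_zero]
    · rw [hg0 _ hs, zero_mul]
  · rfl

include hl in
theorem functional_pos_of_mem_coneBox {x : V} (hx : x ∈ G.coneBox l s₀ s₁ B) : 0 < l x := by
  obtain ⟨q, ⟨-, -, h1⟩, rfl⟩ := hx
  exact functional_flow_pos hl (by rw [show l q.2 = 1 from h1]; exact one_pos)

include hν hl in
-- On `0 < l` the coordinates are smooth. Every other point lies outside the compact box carrying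
-- the function, and so has a neighbourhood where the function is zero.
theorem contDiff_coneFun (hg : ContDiff ℝ ∞ g) (hψ : ContDiff ℝ ∞ ψ) (hB : IsCompact B)
    (hg0 : ∀ s ∉ Icc s₀ s₁, g s = 0) (hψ0 : ∀ y ∉ B, ψ y = 0) :
    ContDiff ℝ ∞ (G.coneFun l ν g ψ) := by
  rw [contDiff_iff_contDiffAt]
  intro x
  by_cases hx : 0 < l x
  · have hσ : ContDiffAt ℝ ∞ (logRadius l ν) x :=
      (l.contDiff.contDiffAt.log hx.ne').div_const ν
    have hπ : ContDiffAt ℝ ∞ (G.hyperProj l ν) x :=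
      G.contDiff_flow.contDiffAt.comp x (hσ.neg.prodMk contDiffAt_id)
    refine ((hg.contDiffAt.comp x hσ).mul (hψ.contDiffAt.comp x hπ)).congr_of_eventuallyEq ?_
    filter_upwards [(isOpen_lt continuous_const l.continuous).mem_nhds hx] with y hy
    rw [coneFun, if_pos (show 0 < l y from hy)]; rfl
  · have hx' : x ∉ G.coneBox l s₀ s₁ B := fun h => hx (functional_pos_of_mem_coneBox hl h)
    refine (contDiffAt_const (c := (0 : ℝ))).congr_of_eventuallyEq ?_
    filter_upwards [(isCompact_coneBox hB).isClosed.isOpen_compl.mem_nhds hx'] with y hy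
    exact coneFun_eq_zero hν hl hg0 hψ0 hy

include hν hl in
theorem coneFun_mem_testFunctions (N : G.QuasiNorm) {R : ℝ} (hg : ContDiff ℝ ∞ g)
    (hψ : ContDiff ℝ ∞ ψ) (hB : IsCompact B)
    (hg0 : ∀ s ∉ Icc s₀ s₁, g s = 0) (hψ0 : ∀ y ∉ B, ψ y = 0)
    (hK : G.coneBox l s₀ s₁ B ⊆ N.puncturedBall R) :
    (fun x => (G.coneFun l ν g ψ x : ℂ)) ∈ N.testFunctions R := by
  have hKc : IsCompact (G.coneBox l s₀ s₁ B) := isCompact_coneBox hB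
  have hz : ∀ x ∉ G.coneBox l s₀ s₁ B, (G.coneFun l ν g ψ x : ℂ) = 0 := fun x hx => by
    rw [coneFun_eq_zero hν hl hg0 hψ0 hx, Complex.ofReal_zero]
  refine ⟨Complex.ofRealCLM.contDiff.comp (contDiff_coneFun hν hl hg hψ hB hg0 hψ0),
    HasCompactSupport.intro hKc hz, subset_trans ?_ hK⟩
  refine closure_minimal (fun x hx => ?_) hKc.isClosed
  by_contra hne
  exact hx (hz x hne)

include hν hl in
-- A dilation translates the logarithmic radius and fixes the projection, so `E` differentiates only
-- the factor `g`.
theorem euler_coneFun (hg : Differentiable ℝ g)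
    (hf : Differentiable ℝ fun x => (G.coneFun l ν g ψ x : ℂ)) {x : V} (hx : 0 < l x) :
    G.euler (fun x => (G.coneFun l ν g ψ x : ℂ)) x =
      (deriv g (logRadius l ν x) * ψ (G.hyperProj l ν x) : ℝ) := by
  have h1 := G.hasDerivAt_flow 0 x
  have h2 : HasFDerivAt (fun x => (G.coneFun l ν g ψ x : ℂ))
      (fderiv ℝ (fun x => (G.coneFun l ν g ψ x : ℂ)) x) (G.flow 0 x) := by
    rw [flow_zero]; exact (hf x).hasFDerivAt
  have h3 := h2.comp_hasDerivAt (0 : ℝ) h1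
  rw [flow_zero] at h3
  have h4 : HasDerivAt (fun t => g (logRadius l ν x + t)) (deriv g (logRadius l ν x)) 0 := by
    have := (hg (logRadius l ν x + 0)).hasDerivAt.comp_const_add (logRadius l ν x) 0
    simpa using this
  have h5 := (h4.mul_const (ψ (G.hyperProj l ν x))).ofReal_comp
  refine h3.unique (h5.congr_of_eventuallyEq (Filter.Eventually.of_forall fun t => ?_))
  simp only [Function.comp_apply, coneFun_flow hν hl g ψ t hx]

theorem measurable_logRadius [MeasurableSpace V] [BorelSpace V] :
    Measurable (logRadius l ν) :=
  (Real.measurable_log.comp l.continuous.measurable).div_const ν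

theorem measurable_hyperProj [MeasurableSpace V] [BorelSpace V] :
    Measurable (G.hyperProj l ν) :=
  G.continuous_flow.measurable.comp (measurable_logRadius.neg.prodMk measurable_id)

variable [MeasurableSpace V] [BorelSpace V] (μ : Measure V) [μ.IsHaarMeasure]

include hν hl in
/-- Integration of functions in product form over the half space `0 < l`. -/
theorem exists_integral_cone {ψ : V → ℝ} (hψ : Continuous ψ) (hψnn : ∀ y, 0 ≤ ψ y)
    (hψ1 : ∀ y, ψ y ≤ 1) (hB : IsCompact B) (hψ0 : ∀ y ∉ B, ψ y = 0) {y₀ : V} (hy₀ : l y₀ = 1)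
    (hψy : 0 < ψ y₀) :
    ∃ m : ℝ, 0 < m ∧ ∀ H : ℝ → ℝ, Measurable H → (∀ s, 0 ≤ H s) →
      ∫ x in {x | 0 < l x}, H (logRadius l ν x) * ψ (G.hyperProj l ν x) ∂μ =
        m * ∫ s, H s * Real.exp (s * G.homDim) := by
  have : IsTopologicalGroup V := topologicalGroup_of_lieGroup 𝓘(ℝ, V) ∞
  set D : Set V := {x | 0 < l x} with hD
  have hDo : IsOpen D := isOpen_lt continuous_const l.continuous
  set h : V → ENNReal := fun x => ENNReal.ofReal (ψ (G.hyperProj l ν x)) with hh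
  have hψm : Measurable fun x => ψ (G.hyperProj l ν x) := hψ.measurable.comp measurable_hyperProj
  have hhm : Measurable h := hψm.ennreal_ofReal
  set S := D ∩ logRadius l ν ⁻¹' Ico 0 1 with hS
  have hSm : MeasurableSet S := hDo.measurableSet.inter (measurable_logRadius measurableSet_Ico)
  set M := ∫⁻ x in S, ENNReal.ofReal (Real.exp (-(logRadius l ν x * G.homDim))) * h x ∂μ with hM
  have hpol := fun {H : ℝ → ENNReal} (hH : Measurable H) =>
    G.lintegral_polar μ hDo.measurableSet (fun t x hx => functional_flow_pos hl hx)
      measurable_logRadius (fun t x hx => logRadius_flow hν hl t hx) hH hhm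
      (fun t x hx => by simp only [hh, hyperProj_flow hν hl t hx])
  have hem : Measurable fun x => ENNReal.ofReal (Real.exp (-(logRadius l ν x * G.homDim))) :=
    (Real.measurable_exp.comp (measurable_logRadius.mul_const _).neg).ennreal_ofReal
  -- The part of the slab where `ψ` can be nonzero lies in a compact box, and the exponential factor
  -- is bounded there.
  have hfin : M ≠ ⊤ := by
    have hK : IsCompact (G.coneBox l 0 1 B) := isCompact_coneBox hB
    refine ne_top_of_le_ne_top (ENNReal.mul_ne_top (ENNReal.ofReal_ne_top
      (r := Real.exp |G.homDim|)) (hK.measure_lt_top (μ := μ)).ne) ?_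
    rw [hM, ← lintegral_indicator hSm, ← setLIntegral_const, ← lintegral_indicator hK.measurableSet]
    refine lintegral_mono fun x => ?_
    by_cases hx : x ∈ S
    · rw [indicator_of_mem hx]
      by_cases hxB : G.hyperProj l ν x ∈ B
      · rw [indicator_of_mem (mem_coneBox hν hl hx.1 ⟨hx.2.1, hx.2.2.le⟩ hxB)]
        refine (mul_le_of_le_one_right' (ENNReal.ofReal_le_one.2 (hψ1 _))).trans
          (ENNReal.ofReal_le_ofReal (Real.exp_le_exp.2 ((neg_le_abs _).trans ?_)))
        rw [abs_mul]
        exact mul_le_of_le_one_left (abs_nonneg _)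
          (abs_le.2 ⟨by linarith [hx.2.1], hx.2.2.le⟩)
      · simp [hh, hψ0 _ hxB]
    · rw [indicator_of_notMem hx]; exact zero_le
  -- The base point `y₀` has logarithmic radius 0, an endpoint of `[0, 1)`; flowing for time `1 / 2`
  -- moves it inside, around which the integrand is positive on an open set.
  have hpos : M ≠ 0 := by
    intro h0
    have hmul : Measurable fun x =>
        ENNReal.ofReal (Real.exp (-(logRadius l ν x * G.homDim))) * h x := hem.mul hhm
    rw [hM, lintegral_eq_zero_iff hmul, Filter.EventuallyEq, ae_restrict_iff' hSm,
      ae_iff] at h0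
    have hy1 : 0 < l y₀ := by rw [hy₀]; exact one_pos
    have hopen : IsOpen (D ∩ (fun x => (logRadius l ν x, ψ (G.hyperProj l ν x))) ⁻¹'
        (Ioo 0 1 ×ˢ Ioi 0)) := by
      refine ContinuousOn.isOpen_inter_preimage ?_ hDo (isOpen_Ioo.prod isOpen_Ioi)
      have hσ : ContinuousOn (logRadius l ν) D := fun x hx =>
        ((l.continuous.continuousAt.log (ne_of_gt hx)).div_const ν).continuousWithinAt
      exact hσ.prodMk (hψ.comp_continuousOn
        (G.continuous_flow.comp_continuousOn (hσ.neg.prodMk continuousOn_id)))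
    refine (hopen.measure_pos μ ⟨G.flow (1 / 2) y₀, functional_flow_pos hl hy1, ?_⟩).ne'
      (measure_mono_null ?_ h0)
    · rw [mem_preimage, logRadius_flow hν hl _ hy1, hyperProj_flow hν hl _ hy1,
        hyperProj_of_functional_eq_one hy₀, logRadius, hy₀, Real.log_one, zero_div]
      exact ⟨⟨by norm_num, by norm_num⟩, hψy⟩
    · rintro x ⟨hxD, hx1, hx2⟩ himp
      have := himp ⟨hxD, hx1.1.le, hx1.2⟩
      rcases mul_eq_zero.1 this with h1 | h1
      · exact (Real.exp_pos _).not_ge (ENNReal.ofReal_eq_zero.1 h1)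
      · exact not_le.2 hx2 (ENNReal.ofReal_eq_zero.1 h1)
  refine ⟨M.toReal, ENNReal.toReal_pos hpos hfin, fun H hHm hH0 => ?_⟩
  have he : Measurable fun s : ℝ => Real.exp (s * G.homDim) :=
    Real.measurable_exp.comp (measurable_id.mul_const _)
  rw [integral_eq_lintegral_of_nonneg_ae
      (Filter.Eventually.of_forall fun x => mul_nonneg (hH0 _) (hψnn _))
      ((hHm.comp measurable_logRadius).mul hψm).aestronglyMeasurable,
    integral_eq_lintegral_of_nonneg_ae
      (Filter.Eventually.of_forall fun s => mul_nonneg (hH0 _) (Real.exp_pos _).le)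
      (hHm.mul he).aestronglyMeasurable, ← ENNReal.toReal_mul]
  have := hpol (H := fun s => ENNReal.ofReal (H s)) hHm.ennreal_ofReal
  simp only [hh, ← ENNReal.ofReal_mul (hH0 _)] at this
  exact congrArg _ this

end Chart

end HomogeneousLieGroup

/-! ### Comparison of weights and sharpness on the group. -/

/-- The weight `QuasiNorm.weight` as a function of the logarithm of the quasi-norm. -/
def logWeight (a s t τ : ℝ) : ℝ := (Real.exp (s * τ) * (a - τ) ^ t)⁻¹

theorem logWeight_pos {a s t τ : ℝ} (h : τ < a) : 0 < logWeight a s t τ :=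
  inv_pos.2 (mul_pos (Real.exp_pos _) (Real.rpow_pos_of_pos (sub_pos.2 h) _))

theorem continuousAt_logWeight {a s t τ : ℝ} (h : τ < a) : ContinuousAt (logWeight a s t) τ :=
  ContinuousAt.inv₀ (((continuousAt_const.mul continuousAt_id).rexp).mul
    ((continuousAt_const.sub continuousAt_id).rpow_const (Or.inl (sub_pos.2 h).ne')))
    (mul_pos (Real.exp_pos _) (Real.rpow_pos_of_pos (sub_pos.2 h) _)).ne'

theorem measurable_logWeight (a s t : ℝ) : Measurable (logWeight a s t) :=
  ((Real.measurable_exp.comp (measurable_id.const_mul s)).mul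
    ((measurable_id.const_sub a).pow_const t)).inv

/-- As `κ y → 0` the shifted and unshifted weights become comparable by continuity and positivity;
compactness of `[s₀, s₁]` gives one neighbourhood of `y₀` valid for all `τ`. -/
theorem eventually_logWeight {X : Type*} [TopologicalSpace X] {κ : X → ℝ} {y₀ : X}
    (hκ : ContinuousAt κ y₀) (hκ0 : κ y₀ = 0) {a s₀ s₁ θ : ℝ} (hs₁ : s₁ < a) (hθ : θ < 1)
    (s t : ℝ) :
    ∀ᶠ y in nhds y₀, ∀ τ ∈ Icc s₀ s₁, θ * logWeight a s t τ ≤ logWeight a s t (τ + κ y) ∧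
      θ * logWeight a s t (τ + κ y) ≤ logWeight a s t τ := by
  refine isCompact_Icc.eventually_forall_of_forall_eventually fun τ hτ => ?_
  have hτa : τ < a := hτ.2.trans_lt hs₁
  have hW := logWeight_pos (s := s) (t := t) hτa
  have h1 : ContinuousAt (fun z : X × ℝ => logWeight a s t z.2) (y₀, τ) :=
    ContinuousAt.comp (g := logWeight a s t) (continuousAt_logWeight hτa) continuousAt_snd
  have hadd : ContinuousAt (fun z : X × ℝ => z.2 + κ z.1) (y₀, τ) :=
    continuousAt_snd.add (ContinuousAt.comp (g := κ) hκ continuousAt_fst)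
  have h2 : ContinuousAt (fun z : X × ℝ => logWeight a s t (z.2 + κ z.1)) (y₀, τ) := by
    refine ContinuousAt.comp (g := logWeight a s t) (f := fun z : X × ℝ => z.2 + κ z.1)
      (x := (y₀, τ)) ?_ hadd
    simp only [hκ0, add_zero]
    exact continuousAt_logWeight hτa
  have hlt : θ * logWeight a s t τ < logWeight a s t τ := mul_lt_of_lt_one_left hW hθ
  have e1 := (continuousAt_const.mul h1).eventually_lt h2 (f := fun z : X × ℝ =>
    θ * logWeight a s t z.2) (by simpa [hκ0] using hlt)
  have e2 := (continuousAt_const.mul h2).eventually_lt h1 (f := fun z : X × ℝ =>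
    θ * logWeight a s t (z.2 + κ z.1)) (by simpa [hκ0] using hlt)
  filter_upwards [e1, e2] with z h3 h4
  exact ⟨h3.le, h4.le⟩

theorem integral_comparison {X : Type*} [MeasurableSpace X] {μ : Measure X} {F K : X → ℝ}
    (hF : Integrable F μ) (hK : AEStronglyMeasurable K μ) (hK0 : ∀ x, 0 ≤ K x) {θ : ℝ}
    (hθ : 0 < θ) (h1 : ∀ x, θ * K x ≤ F x) (h2 : ∀ x, θ * F x ≤ K x) :
    θ * ∫ x, K x ∂μ ≤ ∫ x, F x ∂μ ∧ θ * ∫ x, F x ∂μ ≤ ∫ x, K x ∂μ := by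
  have hKi : Integrable K μ := by
    refine (hF.const_mul θ⁻¹).mono' hK (Filter.Eventually.of_forall fun x => ?_)
    rw [Real.norm_of_nonneg (hK0 x), inv_mul_eq_div, le_div_iff₀ hθ, mul_comm]
    exact h1 x
  rw [← integral_const_mul, ← integral_const_mul]
  exact ⟨integral_mono (hKi.const_mul θ) hF h1, integral_mono (hF.const_mul θ) hKi h2⟩

namespace HomogeneousLieGroup

variable {V : Type*} [NormedAddCommGroup V] [NormedSpace ℝ V] [Group V] [LieGroup 𝓘(ℝ, V) ∞ V]
  {G : HomogeneousLieGroup V} [FiniteDimensional ℝ V]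

theorem QuasiNorm.weight_eq_logWeight (N : G.QuasiNorm) {R : ℝ} (hR : 0 < R) (s t : ℝ) {x : V}
    (hx : 0 < N.nrm x) : N.weight R s t x = logWeight (Real.log R) s t (Real.log (N.nrm x)) := by
  rw [weight, logWeight, Real.log_div hR.ne' hx.ne', Real.rpow_def_of_pos hx, mul_comm s]

theorem QuasiNorm.log_nrm_eq (N : G.QuasiNorm) (l : V →L[ℝ] ℝ) (ν : ℝ) {x : V}
    (hx : 0 < N.nrm (G.hyperProj l ν x)) :
    Real.log (N.nrm x) = logRadius l ν x + Real.log (N.nrm (G.hyperProj l ν x)) := by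
  conv_lhs => rw [← flow_hyperProj (G := G) (l := l) (ν := ν) x, N.nrm_flow,
    Real.log_mul (Real.exp_pos _).ne' hx.ne', Real.log_exp]

/-- On a thin cone the quasi-norm may be replaced by the radius of a homogeneous functional. -/
theorem QuasiNorm.integral_cone_weight_comparison [MeasurableSpace V] [BorelSpace V]
    (μ : Measure V) (N : G.QuasiNorm)
    {R : ℝ} (hR : 0 < R) {l : V →L[ℝ] ℝ} {ν : ℝ} {p θ s t s₀ s₁ m : ℝ} (hp : 0 < p) (hθ : 0 < θ)
    (hs₁ : s₁ < Real.log R) {g : ℝ → ℝ} (hg : Continuous g) (hg0 : ∀ τ ∉ Icc s₀ s₁, g τ = 0)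
    {ψ : V → ℝ} (hψ : Continuous ψ) {B : Set V} (hψ0 : ∀ y ∉ B, ψ y = 0) (hψnn : ∀ y, 0 ≤ ψ y)
    (hB : ∀ y ∈ B, 0 < N.nrm y ∧ ∀ τ ∈ Icc s₀ s₁,
      θ * logWeight (Real.log R) s t τ ≤ logWeight (Real.log R) s t (τ + Real.log (N.nrm y)) ∧
      θ * logWeight (Real.log R) s t (τ + Real.log (N.nrm y)) ≤ logWeight (Real.log R) s t τ)
    (hm : ∀ H : ℝ → ℝ, Measurable H → (∀ s, 0 ≤ H s) →
      ∫ x in {x | 0 < l x}, H (logRadius l ν x) * ψ (G.hyperProj l ν x) ^ p ∂μ =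
        m * ∫ s, H s * Real.exp (s * G.homDim))
    {q : V → ℂ} (hq : ∀ x, 0 < l x → q x = (g (logRadius l ν x) * ψ (G.hyperProj l ν x) : ℝ))
    (hq0 : ∀ x, ¬ 0 < l x → q x = 0)
    (hint : Integrable (fun x => ‖q x‖ ^ p * N.weight R s t x) μ) :
    θ * (m * ∫ τ, |g τ| ^ p * logWeight (Real.log R) s t τ * Real.exp (τ * G.homDim)) ≤
        ∫ x, ‖q x‖ ^ p * N.weight R s t x ∂μ ∧
      θ * ∫ x, ‖q x‖ ^ p * N.weight R s t x ∂μ ≤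
        m * ∫ τ, |g τ| ^ p * logWeight (Real.log R) s t τ * Real.exp (τ * G.homDim) := by
  set D : Set V := {x | 0 < l x} with hD
  have hDm : MeasurableSet D := (isOpen_lt continuous_const l.continuous).measurableSet
  set H : ℝ → ℝ := fun τ => |g τ| ^ p * logWeight (Real.log R) s t τ with hH
  have hHm : Measurable H := (hg.abs.measurable.pow_const p).mul (measurable_logWeight _ _ _)
  have hH0 : ∀ τ, 0 ≤ H τ := fun τ => by
    by_cases hτ : τ ∈ Icc s₀ s₁
    · exact mul_nonneg (Real.rpow_nonneg (abs_nonneg _) _)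
        (logWeight_pos (hτ.2.trans_lt hs₁)).le
    · simp [hH, hg0 τ hτ, Real.zero_rpow hp.ne']
  set K : V → ℝ := D.indicator fun x => H (logRadius l ν x) * ψ (G.hyperProj l ν x) ^ p with hK
  have hKm : Measurable K := ((hHm.comp measurable_logRadius).mul
    ((hψ.measurable.comp measurable_hyperProj).pow_const p)).indicator hDm
  have hK0 : ∀ x, 0 ≤ K x := fun x => indicator_nonneg
    (fun x _ => mul_nonneg (hH0 _) (Real.rpow_nonneg (hψnn _) _)) x
  have hcmp : ∀ x, θ * K x ≤ ‖q x‖ ^ p * N.weight R s t x ∧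
      θ * (‖q x‖ ^ p * N.weight R s t x) ≤ K x := by
    intro x
    by_cases hx : x ∈ D
    · have hnorm : ‖q x‖ ^ p = |g (logRadius l ν x)| ^ p * ψ (G.hyperProj l ν x) ^ p := by
        rw [hq x hx, Complex.norm_real, Real.norm_eq_abs, abs_mul, abs_of_nonneg (hψnn _),
          Real.mul_rpow (abs_nonneg _) (hψnn _)]
      rw [hK, indicator_of_mem hx, hnorm, hH]
      by_cases hτ : logRadius l ν x ∈ Icc s₀ s₁
      · by_cases hy : G.hyperProj l ν x ∈ B
        · obtain ⟨h1, h2⟩ := hB _ hy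
          obtain ⟨h3, h4⟩ := h2 _ hτ
          have hx0 : 0 < N.nrm x := by
            rw [← flow_hyperProj (G := G) (l := l) (ν := ν) x, N.nrm_flow]
            exact mul_pos (Real.exp_pos _) h1
          rw [N.weight_eq_logWeight hR s t hx0, N.log_nrm_eq l ν h1]
          have hA : 0 ≤ |g (logRadius l ν x)| ^ p * ψ (G.hyperProj l ν x) ^ p :=
            mul_nonneg (Real.rpow_nonneg (abs_nonneg _) _) (Real.rpow_nonneg (hψnn _) _)
          have h5 := mul_le_mul_of_nonneg_left h3 hA
          have h6 := mul_le_mul_of_nonneg_left h4 hA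
          constructor <;> linarith
        · simp [hψ0 _ hy, Real.zero_rpow hp.ne']
      · simp [hg0 _ hτ, Real.zero_rpow hp.ne']
    · rw [hK, indicator_of_notMem hx, hq0 x hx]
      simp [Real.zero_rpow hp.ne']
  have hKint : ∫ x, K x ∂μ =
      m * ∫ τ, |g τ| ^ p * logWeight (Real.log R) s t τ * Real.exp (τ * G.homDim) := by
    rw [hK, integral_indicator hDm]
    exact hm H hHm hH0
  rw [← hKint]
  exact integral_comparison hint hKm.aestronglyMeasurable hK0 hθ (fun x => (hcmp x).1)
    fun x => (hcmp x).2

/-- Sharpness of the constant in the Hardy inequality. -/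
theorem QuasiNorm.constant_le [Nontrivial V] [MeasurableSpace V] [BorelSpace V] (μ : Measure V)
    [μ.IsHaarMeasure] (N : G.QuasiNorm) {p α β R C : ℝ} (hp : 1 < p) (hR : 0 < R)
    (hC : ∀ f ∈ N.testFunctions R,
      C * ∫ x in N.ball 1 R, ‖N.hardyTerm p α β R f x‖ ^ p ∂μ ≤
        ∫ x in N.ball 1 R, ‖N.radialTerm p α β R f x‖ ^ p ∂μ) :
    C ≤ |(β + p) / p| ^ p := by
  -- Only positive `C` may be multiplied into the comparison inequalities below.
  rcases le_or_gt C 0 with hC0 | hC0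
  · exact hC0.trans (Real.rpow_nonneg (abs_nonneg _) _)
  have hp0 : 0 < p := by linarith
  obtain ⟨l, ν, y₀, hν, hl, hly₀, hNy₀⟩ := N.exists_homogeneous_functional
  -- The exponent `γ = Q - α - p` collects the polar density `e^(sQ)` and the weight `|x|^(-α-p) ≈
  -- e^(-(α+p)s)`.
  refine le_of_forall_oneDim (a := Real.log R) (γ := G.homDim - α - p) hp ?_
  rintro g hg ⟨s₀, s₁, hs₁, hg0⟩
  have hdg0 : ∀ s ∉ Icc s₀ s₁, deriv g s = 0 := by
    intro s hs
    have hev : g =ᶠ[nhds s] fun _ => 0 := by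
      filter_upwards [isClosed_Icc.isOpen_compl.mem_nhds hs] with q hq
      exact hg0 q hq
    rw [hev.deriv_eq, deriv_const]
  have hI : ∀ (w : ℝ → ℝ) (t : ℝ),
      ∫ s, |w s| ^ p * ((Real.log R - s) ^ t)⁻¹ * Real.exp ((G.homDim - α - p) * s) =
      ∫ s, |w s| ^ p * logWeight (Real.log R) (α + p) t s * Real.exp (s * G.homDim) := by
    intro w t
    refine integral_congr_ae (Filter.Eventually.of_forall fun s => ?_)
    simp only [logWeight]
    rw [show (G.homDim - α - p) * s = s * G.homDim + -((α + p) * s) by ring, Real.exp_add,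
      Real.exp_neg, mul_inv]
    ring
  rw [hI, hI]
  set I₁ := ∫ s, |g s| ^ p * logWeight (Real.log R) (α + p) (β + p + 1) s *
    Real.exp (s * G.homDim)
  set I₂ := ∫ s, |deriv g s| ^ p * logWeight (Real.log R) (α + p) (β + 1) s *
    Real.exp (s * G.homDim)
  -- One factor `θ` is lost in replacing `log |x|` by the logarithmic radius on each side of the
  -- inequality; `θ → 1` at the end.
  have key : ∀ θ ∈ Ioo (0 : ℝ) 1, θ ^ 2 * (C * I₁) ≤ I₂ := by
    intro θ hθ
    have hκ : ContinuousAt (fun y => Real.log (N.nrm y)) y₀ :=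
      N.continuous_nrm.continuousAt.log (by rw [hNy₀]; exact one_ne_zero)
    have hκ0 : Real.log (N.nrm y₀) = 0 := by rw [hNy₀, Real.log_one]
    have hev0 : ∀ᶠ y in nhds y₀, 0 < N.nrm y :=
      N.continuous_nrm.continuousAt.eventually (lt_mem_nhds (by rw [hNy₀]; exact one_pos))
    have hev1 : ∀ᶠ y in nhds y₀, Real.log (N.nrm y) < Real.log R - s₁ :=
      hκ.eventually (gt_mem_nhds (by simp only [hκ0]; linarith))
    -- On a ball of radius `r` around `y₀`, three things hold together: the quasi-norm is positive,
    -- `log |y| < log R - s₁` keeps the box inside the quasi-ball, and both weights are comparable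
    -- up to `θ`.
    obtain ⟨r, hr, hball⟩ := Metric.nhds_basis_closedBall.eventually_iff.1 (hev0.and (hev1.and
      ((eventually_logWeight (s₀ := s₀) hκ hκ0 hs₁ hθ.2 (α + p) (β + p + 1)).and
        (eventually_logWeight (s₀ := s₀) hκ hκ0 hs₁ hθ.2 (α + p) (β + 1)))))
    let ψ : ContDiffBump y₀ := ⟨r / 2, r, by linarith, by linarith⟩
    set B := Metric.closedBall y₀ r with hBdef
    have hBc : IsCompact B := by
      have : ProperSpace V := FiniteDimensional.proper_real V
      exact isCompact_closedBall _ _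
    have hψ0 : ∀ y ∉ B, ψ y = 0 := fun y hy =>
      ψ.zero_of_le_dist (le_of_lt (not_le.1 hy))
    obtain ⟨m, hm0, hm⟩ := exists_integral_cone hν hl μ (ψ := fun y => ψ y ^ p) (B := B)
      (ψ.continuous.rpow_const fun _ => Or.inr hp0.le) (fun y => Real.rpow_nonneg ψ.nonneg _)
      (fun y => Real.rpow_le_one ψ.nonneg ψ.le_one hp0.le) hBc
      (fun y hy => by simp only [hψ0 y hy, Real.zero_rpow hp0.ne']) hly₀
      (Real.rpow_pos_of_pos (ψ.pos_of_mem_ball (Metric.mem_ball_self hr)) _)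
    have hK : G.coneBox l s₀ s₁ B ⊆ N.puncturedBall R := by
      rintro x ⟨⟨τ, y⟩, ⟨hτ, hy, -⟩, rfl⟩
      obtain ⟨h1, h2, -⟩ := hball hy
      have hpos : 0 < Real.exp τ * N.nrm y := mul_pos (Real.exp_pos _) h1
      rw [N.mem_puncturedBall, N.nrm_flow]
      refine ⟨hpos, ?_⟩
      rw [← Real.log_lt_log_iff hpos hR, Real.log_mul (Real.exp_pos _).ne' h1.ne', Real.log_exp]
      have := hτ.2
      simp only at this
      linarith
    have hf := coneFun_mem_testFunctions hν hl N hg ψ.contDiff hBc hg0 hψ0 hK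
    have hfd := N.differentiable_of_mem hf
    have hsupp : ∀ x, ¬ 0 < l x →
        x ∉ tsupport fun x => (G.coneFun l ν g ψ x : ℂ) := by
      intro x hx h
      refine hx (functional_pos_of_mem_coneBox hl
        (closure_minimal (fun y hy => ?_)
          (isCompact_coneBox (s₀ := s₀) (s₁ := s₁) hBc).isClosed h))
      by_contra hne
      exact hy (by simp only [coneFun_eq_zero hν hl hg0 hψ0 hne, Complex.ofReal_zero])
    have c1 := (N.integral_cone_weight_comparison μ hR hp0 hθ.1 hs₁ hg.continuous hg0
      ψ.continuous hψ0 (fun y => ψ.nonneg) (fun y hy => ⟨(hball hy).1, (hball hy).2.2.1⟩) hm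
      (q := fun x => (G.coneFun l ν g ψ x : ℂ))
      (fun x hx => by simp only [coneFun, if_pos hx])
      (fun x hx => by simp only [coneFun, if_neg hx, Complex.ofReal_zero])
      (N.integrable_mul_weight μ hf (N.continuous_norm_rpow hp hf) (norm_rpow_eq_zero hp) _ _)).1
    have c2 := (N.integral_cone_weight_comparison μ hR hp0 hθ.1 hs₁
      (hg.continuous_deriv (by simp)) hdg0
      ψ.continuous hψ0 (fun y => ψ.nonneg) (fun y hy => ⟨(hball hy).1, (hball hy).2.2.2⟩) hm
      (q := G.euler fun x => (G.coneFun l ν g ψ x : ℂ))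
      (fun x hx => euler_coneFun hν hl (hg.differentiable (by simp)) hfd hx)
      (fun x hx => euler_eq_zero_of_notMem_tsupport (hsupp x hx))
      (N.integrable_mul_weight μ hf (N.continuous_norm_euler_rpow hp hf)
        (norm_euler_rpow_eq_zero hp) _ _)).2
    have c3 := hC _ hf
    rw [N.integral_hardyTerm μ hp hf, N.integral_radialTerm μ hp hf] at c3
    have c4 := mul_le_mul_of_nonneg_left c1 (mul_pos hθ.1 hC0).le
    have c5 := mul_le_mul_of_nonneg_left c3 hθ.1.le
    refine le_of_mul_le_mul_left ?_ hm0
    calc m * (θ ^ 2 * (C * I₁)) = θ * C * (θ * (m * I₁)) := by ring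
      _ ≤ _ := c4
      _ = _ := mul_assoc _ _ _
      _ ≤ _ := c5
      _ ≤ _ := c2
  have hlim : Filter.Tendsto (fun θ : ℝ => θ ^ 2 * (C * I₁)) (nhdsWithin 1 (Iio 1))
      (nhds (C * I₁)) := by
    have : Continuous fun θ : ℝ => θ ^ 2 * (C * I₁) := by fun_prop
    simpa using (this.tendsto 1).mono_left nhdsWithin_le_nhds
  refine le_of_tendsto hlim ?_
  filter_upwards [Ioo_mem_nhdsLT (show (0 : ℝ) < 1 from one_pos)] with θ hθ
  exact key θ hθ

end HomogeneousLieGroup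

end

/-! ### Assembly of the theorem. -/

theorem mainTheorem6 {V : Type*} [NormedAddCommGroup V] [NormedSpace ℝ V]
    [FiniteDimensional ℝ V] [Nontrivial V] [Group V] [LieGroup 𝓘(ℝ, V) ∞ V]
    [MeasurableSpace V] [BorelSpace V] (μ : Measure V) [μ.IsHaarMeasure]
    (G : HomogeneousLieGroup V) (N : G.QuasiNorm)
    (p α β R : ℝ) (hp : 1 < p) (hR : 0 < R) :
    -- nonnegativity of the functional `C_p`
    (∀ ξ η : ℂ, 0 ≤ hardyCp p ξ η) ∧
    -- finiteness of all the integrals below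
    (∀ f ∈ N.testFunctions R,
      IntegrableOn (fun x => ‖N.hardyTerm p α β R f x‖ ^ p) (N.ball 1 R) μ ∧
      IntegrableOn (fun x => ‖N.radialTerm p α β R f x‖ ^ p) (N.ball 1 R) μ ∧
      IntegrableOn (fun x => ‖f x‖ ^ p /
        (N.nrm x ^ (α + p) * Real.log (R / N.nrm x) ^ (β + p))) (N.ball 1 R) μ ∧
      IntegrableOn (fun x => N.remainder p α β R f x) (N.ball 1 R) μ) ∧
    -- the inequality and the sharpness of its constant
    (0 ≤ (G.homDim - α - p) * (β + p) →
      (∀ f ∈ N.testFunctions R,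
        |(β + p) / p| ^ p * ∫ x in N.ball 1 R, ‖N.hardyTerm p α β R f x‖ ^ p ∂μ ≤
          ∫ x in N.ball 1 R, ‖N.radialTerm p α β R f x‖ ^ p ∂μ) ∧
      (β ≠ -p → ∀ C : ℝ,
        (∀ f ∈ N.testFunctions R,
          C * ∫ x in N.ball 1 R, ‖N.hardyTerm p α β R f x‖ ^ p ∂μ ≤
            ∫ x in N.ball 1 R, ‖N.radialTerm p α β R f x‖ ^ p ∂μ) →
        C ≤ |(β + p) / p| ^ p)) ∧
    -- the identity
    (∀ f ∈ N.testFunctions R,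
      |(β + p) / p| ^ p * ∫ x in N.ball 1 R, ‖N.hardyTerm p α β R f x‖ ^ p ∂μ =
        (∫ x in N.ball 1 R, ‖N.radialTerm p α β R f x‖ ^ p ∂μ)
        - (G.homDim - α - p) * ((β + p) / p) * |(β + p) / p| ^ (p - 2) *
          (∫ x in N.ball 1 R, ‖f x‖ ^ p /
            (N.nrm x ^ (α + p) * Real.log (R / N.nrm x) ^ (β + p)) ∂μ)
        - ∫ x in N.ball 1 R, N.remainder p α β R f x ∂μ) ∧
    -- the critical case `Q = α + p`, `p ≥ 2`
    (G.homDim = α + p → 2 ≤ p →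
      -- pointwise vanishing of `C_p`
      (∀ f : V → ℂ, (∀ x ∈ N.puncturedBall R, N.RadialDifferentiableAt f x) →
        ((∀ x ∈ N.puncturedBall R, N.remainder p α β R f x = 0) ↔
          ∃ φ : N.sphere → ℂ, ∀ x ∈ N.puncturedBall R, f x = N.extremal p β R φ x)) ∧
      -- vanishing of the remainder term
      (∀ f ∈ N.testFunctions R,
        ((∫ x in N.ball 1 R, N.remainder p α β R f x ∂μ) = 0 ↔
          ∃ φ : N.sphere → ℂ, ∀ x ∈ N.puncturedBall R, f x = N.extremal p β R φ x)) ∧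
      -- such functions have an infinite left-hand side, unless they vanish
      (∀ φ : N.sphere → ℂ,
        (∀ x ∈ N.puncturedBall R,
          ‖N.hardyTerm p α β R (N.extremal p β R φ) x‖ ^ p =
            ‖N.angularFun φ x‖ ^ p / (N.nrm x ^ G.homDim * Real.log (R / N.nrm x))) ∧
        (Measurable φ → ¬ (N.extremal p β R φ =ᵐ[μ.restrict (N.ball 1 R)] 0) →
          ∫⁻ x in N.ball 1 R,
            ENNReal.ofReal (‖N.hardyTerm p α β R (N.extremal p β R φ) x‖ ^ p) ∂μ = ⊤) ∧
        (Continuous φ → φ ≠ 0 →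
          ∫⁻ x in N.ball 1 R,
            ENNReal.ofReal (‖N.hardyTerm p α β R (N.extremal p β R φ) x‖ ^ p) ∂μ = ⊤)) ∧
      -- the sharp constant is not attained
      (∀ f ∈ N.testFunctions R,
        |(β + p) / p| ^ p * ∫ x in N.ball 1 R, ‖N.hardyTerm p α β R f x‖ ^ p ∂μ =
          ∫ x in N.ball 1 R, ‖N.radialTerm p α β R f x‖ ^ p ∂μ → f = 0)) := by
  refine ⟨fun ξ η => hardyCp_nonneg hp ξ η, fun f hf => N.integrable_all μ hp hf,
    fun h => ⟨fun f hf => N.hardy_inequality μ hp h hf, fun _ C hC => N.constant_le μ hp hR hC⟩,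
    fun f hf => N.hardy_identity μ hp hf, fun hQ _ => ⟨fun f hf => ?_, fun f hf => ?_,
      fun φ => ⟨fun x hx => ?_, fun hφ hne => ?_, fun hφ hne => ?_⟩, fun f hf h => ?_⟩⟩
  · exact N.forall_remainder_eq_zero_iff hp hf
  · exact N.integral_remainder_eq_zero_iff μ hp hf
  · exact N.norm_hardyTerm_extremal hp hQ φ hx
  · exact N.lintegral_extremal_eq_top μ hp hR hQ hφ hne
  · exact N.lintegral_extremal_eq_top μ hp hR hQ hφ.measurable
      (N.not_ae_eq_zero_of_continuous μ hR hφ hne)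
  · exact N.eq_zero_of_equality μ hp hQ hf h
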